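/- Let $G=\mathrm{SL}_3(\mathbb{R})$, $\Gamma=\mathrm{SL}_3(\mathbb{Z})$, and let $X_3=\Gamma\backslash G$ be the space of unimodular lattices in $\mathbb{R}^3$, where the point $\Gamma g$ corresponds to the lattice $\Lambda=\mathbb{Z}^3 g$ (integral row vectors multiplied on the right by $g$). Let $\mu$ be the probability measure on $X_3$ coming from Haar measure on $G$, that is, the image of Haar measure restricted to a fundamental domain of $\Gamma$, divided by the covolume of $\Gamma$. For $\Omega\subseteq\mathbb{R}^3$ put $$B_\Omega=\{\Lambda\in X_3 : \Lambda\cap\Omega\neq\emptyset\}.$$ Then for every Lebesgue measurable set $\Omega\subseteq\mathbb{R}^3$, of finite or infinite volume, the set $B_\Omega$ is $\mu$-measurable (that is, measurable with respect to the completion of $\mu$) and $$\mu(B_\Omega)\;\ge\;\min\left\{\frac15,\ \frac{\mathrm{vol}(\Omega)}{5}\right\}.$$ -/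

import Mathlib

open MeasureTheory Matrix
open scoped ENNReal

noncomputable section

namespace UnimodularLattices

/-- The group `SL₃(ℝ)`, with its topology as a subspace of the `3 × 3` matrices. -/
abbrev G : Type := Matrix.SpecialLinearGroup (Fin 3) ℝ

/-- The subgroup `SL₃(ℤ)` of `SL₃(ℝ)`. -/
abbrev Γ : Subgroup G := (Matrix.SpecialLinearGroup.map (n := Fin 3) (Int.castRingHom ℝ)).range

/-- `SL₃(ℝ)` carries its Borel σ-algebra. -/
instance instMeasurableSpaceG : MeasurableSpace G := borel G

instance instBorelSpaceG : BorelSpace G := ⟨rfl⟩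

instance instLocallyCompactSpaceG : LocallyCompactSpace G :=
  have : LocallyCompactSpace (Matrix (Fin 3) (Fin 3) ℝ) :=
    inferInstanceAs (LocallyCompactSpace (Fin 3 → Fin 3 → ℝ))
  Matrix.SpecialLinearGroup.isClosedEmbedding_val.locallyCompactSpace

instance instSecondCountableTopologyG : SecondCountableTopology G :=
  have : SecondCountableTopology (Matrix (Fin 3) (Fin 3) ℝ) :=
    inferInstanceAs (SecondCountableTopology (Fin 3 → Fin 3 → ℝ))
  Matrix.SpecialLinearGroup.isClosedEmbedding_val.isEmbedding.secondCountableTopology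

instance instCountableΓ : Countable Γ := by
  have : Countable (Matrix (Fin 3) (Fin 3) ℤ) :=
    inferInstanceAs (Countable (Fin 3 → Fin 3 → ℤ))
  have : Countable (Matrix.SpecialLinearGroup (Fin 3) ℤ) := Subtype.countable
  exact (Set.countable_range
    (Matrix.SpecialLinearGroup.map (n := Fin 3) (Int.castRingHom ℝ))).to_subtype

/-- The space `X₃ = SL₃(ℤ) \ SL₃(ℝ)`, the quotient of `SL₃(ℝ)` by left multiplication by `SL₃(ℤ)`,
with the quotient σ-algebra. -/
abbrev X3 : Type := Quotient (MulAction.orbitRel Γ G)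

/-- There is a Borel set that contains exactly one point of each coset `SL₃(ℤ) g`. -/
theorem exists_strict_fundamentalDomain :
    ∃ F : Set G, MeasurableSet F ∧ ∀ g : G, ∃! γ : Γ, γ • g ∈ F := by
  obtain ⟨W, hWo, hW⟩ : ∃ W : Set G, IsOpen W ∧ W ∩ (Γ : Set G) = {1} := by
    have h : IsOpen ({1} : Set Γ) := isOpen_discrete _
    obtain ⟨W, hWo, hW⟩ := isOpen_induced_iff.1 h
    refine ⟨W, hWo, ?_⟩
    ext x
    constructor
    · rintro ⟨hx, hxΓ⟩
      have : (⟨x, hxΓ⟩ : Γ) ∈ ({1} : Set Γ) := by rw [← hW]; exact hx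
      simpa using congrArg Subtype.val (Set.mem_singleton_iff.1 this)
    · rintro rfl
      refine ⟨?_, Γ.one_mem⟩
      have : (1 : Γ) ∈ Subtype.val ⁻¹' W := by rw [hW]; rfl
      exact this
  have hW1 : (1 : G) ∈ W := by
    have : (1 : G) ∈ W ∩ (Γ : Set G) := by rw [hW]; rfl
    exact this.1
  obtain ⟨V, hV1, hV⟩ := exists_nhds_split_inv (hWo.mem_nhds hW1)
  obtain ⟨U, hUV, hUo, hU1⟩ := mem_nhds_iff.1 hV1
  have hcov : ∀ h : G, {g : G | g * h⁻¹ ∈ U} ∈ nhds h := fun h =>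
    (hUo.preimage (continuous_mul_const h⁻¹)).mem_nhds (by simpa using hU1)
  obtain ⟨t, htc, ht⟩ := TopologicalSpace.countable_cover_nhds hcov
  have htne : t.Nonempty := by
    rcases t.eq_empty_or_nonempty with rfl | h
    · have : (1 : G) ∈ (⋃ x ∈ (∅ : Set G), {g : G | g * x⁻¹ ∈ U}) := by rw [ht]; trivial
      simp at this
    · exact h
  obtain ⟨e, he⟩ := htc.exists_eq_range htne
  let P : ℕ → Set G := fun i => {g : G | g * (e i)⁻¹ ∈ U}
  have hPo : ∀ i, IsOpen (P i) := fun i => hUo.preimage (continuous_mul_const (e i)⁻¹)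
  let Q : ℕ → Set G := fun i => ⋃ γ : Γ, {g : G | (γ : G) * g ∈ P i}
  have hQo : ∀ i, IsOpen (Q i) := fun i =>
    isOpen_iUnion fun γ => (hPo i).preimage (continuous_const_mul (γ : G))
  have hQinv : ∀ i (γ : Γ) (g : G), (γ : G) * g ∈ Q i ↔ g ∈ Q i := by
    intro i γ g
    simp only [Q, Set.mem_iUnion, Set.mem_ofPred_eq]
    constructor
    · rintro ⟨δ, hδ⟩
      exact ⟨δ * γ, by simpa [mul_assoc] using hδ⟩
    · rintro ⟨δ, hδ⟩
      exact ⟨δ * γ⁻¹, by simpa [mul_assoc] using hδ⟩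
  have hPQ : ∀ i, P i ⊆ Q i := fun i g hg => Set.mem_iUnion.2 ⟨1, by simpa using hg⟩
  have hall : ∀ g : G, ∃ i, g ∈ Q i := by
    intro g
    have : g ∈ (⋃ x ∈ t, {g : G | g * x⁻¹ ∈ U}) := by rw [ht]; trivial
    simp only [Set.mem_iUnion] at this
    obtain ⟨x, hx, hgx⟩ := this
    rw [he] at hx
    obtain ⟨i, rfl⟩ := hx
    exact ⟨i, hPQ i hgx⟩
  refine ⟨⋃ i, (P i ∩ ⋂ j, ⋂ (_ : j < i), (Q j)ᶜ), ?_, ?_⟩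
  · exact MeasurableSet.iUnion fun i => (hPo i).measurableSet.inter <|
      MeasurableSet.iInter fun j => MeasurableSet.iInter fun _ => (hQo j).measurableSet.compl
  · intro g
    classical
    have hmem : ∀ γ : Γ, γ • g ∈ (⋃ i, (P i ∩ ⋂ j, ⋂ (_ : j < i), (Q j)ᶜ)) ↔
        (γ : G) * g ∈ P (Nat.find (hall g)) := by
      intro γ
      have hsm : γ • g = (γ : G) * g := rfl
      rw [hsm]
      simp only [Set.mem_iUnion, Set.mem_inter_iff, Set.mem_iInter, Set.mem_compl_iff, hQinv]
      constructor
      · rintro ⟨i, hi, hlt⟩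
        have : Nat.find (hall g) = i :=
          (Nat.find_eq_iff _).2 ⟨(hQinv i γ g).1 (hPQ i hi), fun j hj => hlt j hj⟩
        rwa [this]
      · intro h
        exact ⟨_, h, fun j hj => Nat.find_min (hall g) hj⟩
    obtain ⟨γ, hγ⟩ := Set.mem_iUnion.1 (Nat.find_spec (hall g))
    refine ⟨γ, (hmem γ).2 hγ, ?_⟩
    intro δ hδ
    have h1 := hV _ (hUV ((hmem δ).1 hδ)) _ (hUV hγ)
    have h2 : (δ : G) * g * (e (Nat.find (hall g)))⁻¹ /
        ((γ : G) * g * (e (Nat.find (hall g)))⁻¹) = ((δ * γ⁻¹ : Γ) : G) := by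
      simp [div_eq_mul_inv, mul_assoc]
    rw [h2] at h1
    have h3 : ((δ * γ⁻¹ : Γ) : G) ∈ W ∩ (Γ : Set G) := ⟨h1, (δ * γ⁻¹ : Γ).2⟩
    rw [hW] at h3
    have h4 : δ * γ⁻¹ = 1 := Subtype.ext h3
    exact mul_inv_eq_one.1 h4

/-- A fundamental domain for the action of `SL₃(ℤ)` on `SL₃(ℝ)` by left multiplication. -/
def fundDomain : Set G := Classical.choose exists_strict_fundamentalDomain

theorem measurableSet_fundDomain : MeasurableSet fundDomain :=
  (Classical.choose_spec exists_strict_fundamentalDomain).1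

theorem isFundamentalDomain_fundDomain :
    IsFundamentalDomain Γ fundDomain (Measure.haar : Measure G) :=
  IsFundamentalDomain.mk' measurableSet_fundDomain.nullMeasurableSet
    (Classical.choose_spec exists_strict_fundamentalDomain).2

/-- The probability measure `μ` on `X₃` that comes from Haar measure on `SL₃(ℝ)`: the image of
Haar measure on a fundamental domain, divided by the covolume of `SL₃(ℤ)`. It depends neither on
the fundamental domain nor on the normalization of Haar measure. -/
def μ : Measure X3 :=
  ((Measure.haar : Measure G) fundDomain)⁻¹ •
    ((Measure.haar : Measure G).restrict fundDomain).map (Quotient.mk (MulAction.orbitRel Γ G))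

/-- The lattice `ℤ³ g` of all `n g`, where `n` runs through the integral row vectors. -/
def rowLattice (g : G) : AddSubgroup (Fin 3 → ℝ) where
  carrier := {v | ∃ n : Fin 3 → ℤ, (fun i => (n i : ℝ)) ᵥ* (g : Matrix (Fin 3) (Fin 3) ℝ) = v}
  zero_mem' := ⟨0, by ext j; simp [Matrix.vecMul, dotProduct]⟩
  add_mem' := by
    rintro _ _ ⟨m, rfl⟩ ⟨n, rfl⟩
    refine ⟨m + n, ?_⟩
    rw [← Matrix.add_vecMul]
    congr 1
    ext i
    simp
  neg_mem' := by
    rintro _ ⟨n, rfl⟩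
    refine ⟨-n, ?_⟩
    rw [← Matrix.neg_vecMul]
    congr 1
    ext i
    simp

theorem rowLattice_le_of_mul (γ : Γ) (g : G) : rowLattice ((γ : G) * g) ≤ rowLattice g := by
  obtain ⟨_, δ, rfl⟩ := γ
  rintro _ ⟨n, rfl⟩
  refine ⟨n ᵥ* (δ : Matrix (Fin 3) (Fin 3) ℤ), ?_⟩
  rw [Matrix.SpecialLinearGroup.coe_mul, ← Matrix.vecMul_vecMul]
  congr 1
  ext i
  simp [Matrix.vecMul, dotProduct]

/-- The unimodular lattice `ℤ³ g` that corresponds to the point `SL₃(ℤ) g` of `X₃`. -/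
def lattice : X3 → AddSubgroup (Fin 3 → ℝ) :=
  Quotient.lift rowLattice fun a b hab => by
    obtain ⟨γ, rfl⟩ : ∃ γ : Γ, γ • b = a := hab
    refine le_antisymm (rowLattice_le_of_mul γ b) ?_
    have h := rowLattice_le_of_mul γ⁻¹ (γ • b)
    have hb : ((γ⁻¹ : Γ) : G) * (γ • b) = b := inv_smul_smul γ b
    rwa [hb] at h

/-- The set `B_Ω` of all unimodular lattices that meet `Ω`. -/
def B (Ω : Set (Fin 3 → ℝ)) : Set X3 :=
  {x | ((lattice x : Set (Fin 3 → ℝ)) ∩ Ω).Nonempty}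

end UnimodularLattices

end

noncomputable section

namespace UnimodularLattices

open scoped Pointwise

/-! The proof is a second moment argument for a function counting vectors of `Λ ∩ Ω`. Write `c =
cellConst`, `V = vol Ω`, and `h` for the Haar measure of `fundDomain`.

On `cell`, where the last row is reduced modulo the first two, Haar measure projects to `c` times
Lebesgue measure on pairs of rows (`lintegral_cell`). By unfolding, integrals over `fundDomain` of
sums over frames `γ • g` become integrals over `ℝ³ × ℝ³`.

Every independent pair of lattice vectors has the form `(a v, b v + d u)` with `v, u` the first two
vectors of a basis and `0 ≤ b < d`. So the sum of `F` over such pairs has integral at most `c ζ(3)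
ζ(2) ∫ F ≤ c (5π²/24) ∫ F` (`lintegral_indep_le`). For large boxes in independent directions,
Fatou's lemma turns this into `h ≤ 5π²c/24` (`haar_fundDomain_le`). For `Ω × Ω` it controls the
second moment.

A vector `v` has many completions to a basis. `count` admits only those whose second vector projects
along `v` into a half disc of radius `|v 0|^(-1/2)`. The projected lattice has covolume `1/|v 0|`,
so two of its vectors inside the disc are dependent. The half disc fixes the sign, and at most one
completion survives (`eq_one_of_mem_halfDiscPairs`). Thus `count Ω` counts distinct vectors of `Ω`;
its integral is `c (π/2) V`, and parallel pairs contribute at most `2 * count Ω` to its square.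

If `p` is the measure of the set where `count Ω ≠ 0`, Cauchy–Schwarz gives `(cπV/2)² ≤ (5π²c V²/24 +
cπV) p`. With the bound on `h`, `p / h ≥ (6/(5π)) V / (5πV/24 + 1) ≥ min 1 V / 5`. -/

/-! ### Haar measure on `SL₃(ℝ)` as a cone measure. -/

/-- Determinant of a triple of row vectors. -/
def rowDet (M : Fin 3 → Fin 3 → ℝ) : ℝ := Matrix.det (Matrix.of M)

theorem rowDet_eq (M : Fin 3 → Fin 3 → ℝ) : rowDet M =
    M 0 0 * M 1 1 * M 2 2 - M 0 0 * M 1 2 * M 2 1 - M 0 1 * M 1 0 * M 2 2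
    + M 0 1 * M 1 2 * M 2 0 + M 0 2 * M 1 0 * M 2 1 - M 0 2 * M 1 1 * M 2 0 := by
  simp [rowDet, Matrix.det_fin_three]

theorem continuous_rowDet : Continuous rowDet := by
  rw [show rowDet = _ from funext rowDet_eq]; fun_prop

theorem rowDet_smul (c : ℝ) (M : Fin 3 → Fin 3 → ℝ) : rowDet (c • M) = c ^ 3 * rowDet M := by
  simp only [rowDet_eq, Pi.smul_apply, smul_eq_mul]; ring

/-- The rows of an element of `SL₃(ℝ)`. -/
def rows (g : G) : Fin 3 → Fin 3 → ℝ := fun i j => g.1 i j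

theorem rowDet_rows (g : G) : rowDet (rows g) = 1 := g.2

theorem isClosedEmbedding_rows : Topology.IsClosedEmbedding rows :=
  Matrix.SpecialLinearGroup.isClosedEmbedding_val

theorem measurableEmbedding_rows : MeasurableEmbedding rows :=
  isClosedEmbedding_rows.measurableEmbedding

theorem measurable_rows : Measurable rows := measurableEmbedding_rows.measurable

theorem cube_det_rpow {d : ℝ} (hd : 0 < d) : (d ^ (-1 / 3 : ℝ)) ^ 3 * d = 1 := by
  rw [← Real.rpow_natCast, ← Real.rpow_mul hd.le]
  norm_num
  rw [Real.rpow_neg_one, inv_mul_cancel₀ hd.ne']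

/-- Rescale a triple with positive determinant to determinant one. -/
def coneProj (M : Fin 3 → Fin 3 → ℝ) : G :=
  if h : 0 < rowDet M then ⟨Matrix.of ((rowDet M) ^ (-1 / 3 : ℝ) • M), by
    have := rowDet_smul ((rowDet M) ^ (-1 / 3 : ℝ)) M
    rw [cube_det_rpow h] at this
    exact (show Matrix.det (Matrix.of ((rowDet M) ^ (-1 / 3 : ℝ) • M)) = 1 from this)⟩ else 1

theorem rows_coneProj {M : Fin 3 → Fin 3 → ℝ} (h : 0 < rowDet M) :
    rows (coneProj M) = (rowDet M) ^ (-1 / 3 : ℝ) • M := by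
  have h' : coneProj M = ⟨Matrix.of ((rowDet M) ^ (-1 / 3 : ℝ) • M), _⟩ := dif_pos h
  rw [h']
  rfl

theorem measurable_coneProj : Measurable coneProj := by
  rw [← measurableEmbedding_rows.measurable_comp_iff]
  have h : rows ∘ coneProj = fun M => if 0 < rowDet M then (rowDet M) ^ (-1 / 3 : ℝ) • M
      else rows 1 := by
    funext M
    by_cases hM : 0 < rowDet M
    · simp [hM, rows_coneProj hM]
    · simp [hM, coneProj]
  rw [h]
  have hd := continuous_rowDet.measurable
  exact Measurable.ite (measurableSet_lt measurable_const hd)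
    ((hd.pow_const _).smul measurable_id) measurable_const

/-- The cone of triples with determinant in `(0, 1]`. -/
def cone : Set (Fin 3 → Fin 3 → ℝ) := {M | 0 < rowDet M ∧ rowDet M ≤ 1}

theorem measurableSet_cone : MeasurableSet cone :=
  (measurableSet_lt measurable_const continuous_rowDet.measurable).inter
    (measurableSet_le continuous_rowDet.measurable measurable_const)

/-- The cone measure on `SL₃(ℝ)`. -/
def coneMeasure : Measure G := (volume.restrict cone).map coneProj

theorem lintegral_coneMeasure {f : G → ℝ≥0∞} (hf : Measurable f) :
    ∫⁻ g, f g ∂coneMeasure = ∫⁻ M in cone, f (coneProj M) := by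
  rw [coneMeasure, lintegral_map hf measurable_coneProj]

/-- Left multiplication of a triple of rows by a matrix. -/
def leftMul (A : Matrix (Fin 3) (Fin 3) ℝ) :
    (Fin 3 → Fin 3 → ℝ) →ₗ[ℝ] (Fin 3 → Fin 3 → ℝ) where
  toFun M := A * Matrix.of M
  map_add' M N := Matrix.mul_add A (Matrix.of M) (Matrix.of N)
  map_smul' c M := Matrix.mul_smul A c (Matrix.of M)

/-- `A` acts on each of the three columns separately, hence the cube; transposition exhibits the
columns as factors of a product. -/
theorem det_leftMul (A : Matrix (Fin 3) (Fin 3) ℝ) : LinearMap.det (leftMul A) = A.det ^ 3 := by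
  let s : (Fin 3 → Fin 3 → ℝ) ≃ₗ[ℝ] (Fin 3 → Fin 3 → ℝ) := Matrix.transposeLinearEquiv (Fin 3) (Fin 3) ℝ ℝ
  have h : leftMul A = s.symm.toLinearMap ∘ₗ
      (LinearMap.pi fun i => Matrix.toLin' A ∘ₗ LinearMap.proj i) ∘ₗ s.toLinearMap := by
    ext M i j
    simp [leftMul, s]
    rfl
  have h1 := LinearEquiv.det_symm_mul_det s
  rw [h, LinearMap.det_comp, LinearMap.det_comp, LinearMap.det_pi]
  simp only [LinearMap.det_toLin', Finset.prod_const, Finset.card_univ, Fintype.card_fin]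
  linear_combination A.det ^ 3 * h1

theorem rowDet_leftMul (A : Matrix (Fin 3) (Fin 3) ℝ) (M : Fin 3 → Fin 3 → ℝ) :
    rowDet (leftMul A M) = A.det * rowDet M := Matrix.det_mul A (Matrix.of M)

theorem measurePreserving_leftMul (g : G) : MeasurePreserving (leftMul g.1) := by
  have h : LinearMap.det (leftMul g.1) = 1 := by simp [det_leftMul, g.2]
  refine ⟨(leftMul g.1).continuous_of_finiteDimensional.measurable, ?_⟩
  rw [Measure.map_linearMap_addHaar_eq_smul_addHaar _ (by simp [h]), h]
  simp

theorem rows_mul (g h : G) : rows (g * h) = leftMul g.1 (rows h) := rfl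

theorem coneProj_leftMul (g : G) (M : Fin 3 → Fin 3 → ℝ) (hM : 0 < rowDet M) :
    coneProj (leftMul g.1 M) = g * coneProj M := by
  have hd : rowDet (leftMul g.1 M) = rowDet M := by rw [rowDet_leftMul, g.2, one_mul]
  apply isClosedEmbedding_rows.injective
  rw [rows_coneProj (by rwa [hd]), rows_mul, rows_coneProj hM, hd, map_smul]

instance : coneMeasure.IsMulLeftInvariant := by
  refine ⟨fun g => ?_⟩
  have hpre : leftMul g.1 ⁻¹' cone = cone := by
    ext M; simp [cone, rowDet_leftMul, g.2]
  have hmp := (measurePreserving_leftMul g).restrict_preimage measurableSet_cone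
  rw [hpre] at hmp
  ext s hs
  rw [Measure.map_apply (measurable_const_mul g) hs, coneMeasure,
    Measure.map_apply measurable_coneProj (measurable_const_mul g hs),
    Measure.map_apply measurable_coneProj hs]
  conv_rhs => rw [← hmp.map_eq, Measure.map_apply hmp.measurable (measurable_coneProj hs)]
  rw [Measure.restrict_apply (measurable_coneProj (measurable_const_mul g hs)),
    Measure.restrict_apply (hmp.measurable (measurable_coneProj hs))]
  congr 1
  ext M
  simp only [Set.mem_inter_iff, Set.mem_preimage, and_congr_left_iff]
  intro hM
  rw [coneProj_leftMul g M hM.1]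

theorem coneMeasure_ne_zero : coneMeasure ≠ 0 := by
  intro h
  have h1 : coneMeasure Set.univ = 0 := by simp [h]
  rw [coneMeasure, Measure.map_apply measurable_coneProj MeasurableSet.univ, Set.preimage_univ,
    Measure.restrict_apply_univ] at h1
  have ho : IsOpen {M : Fin 3 → Fin 3 → ℝ | 0 < rowDet M ∧ rowDet M < 1} :=
    (isOpen_lt continuous_const continuous_rowDet).inter
      (isOpen_lt continuous_rowDet continuous_const)
  have hne : {M : Fin 3 → Fin 3 → ℝ | 0 < rowDet M ∧ rowDet M < 1}.Nonempty := by
    refine ⟨(1 / 2 : ℝ) • rows 1, ?_⟩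
    simp only [Set.mem_ofPred_eq, rowDet_smul, rowDet_rows]
    norm_num
  exact (ho.measure_pos volume hne).ne' (measure_mono_null
    (show _ ⊆ cone from fun M hM => ⟨hM.1, hM.2.le⟩) h1)

instance : IsFiniteMeasureOnCompacts coneMeasure := by
  refine ⟨fun K hK => ?_⟩
  rw [coneMeasure, Measure.map_apply measurable_coneProj hK.measurableSet,
    Measure.restrict_apply (measurable_coneProj hK.measurableSet)]
  obtain ⟨R, hR⟩ := (hK.image isClosedEmbedding_rows.continuous).isBounded.exists_norm_le
  refine lt_of_le_of_lt (measure_mono ?_) (measure_closedBall_lt_top (x := (0 : Fin 3 → Fin 3 → ℝ)) (r := R))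
  rintro M ⟨hMK, hM0, hM1⟩
  rw [mem_closedBall_zero_iff]
  have h1 := hR _ ⟨_, hMK, rfl⟩
  rw [rows_coneProj hM0, norm_smul] at h1
  -- Determinant at most one makes the rescaling factor at least one, so the cone over `K` stays
  -- inside a ball containing `K`.
  have h2 : 1 ≤ ‖(rowDet M) ^ (-1 / 3 : ℝ)‖ := by
    rw [Real.norm_of_nonneg (by positivity)]
    exact Real.one_le_rpow_of_pos_of_le_one_of_nonpos hM0 hM1 (by norm_num)
  nlinarith [norm_nonneg M]

theorem exists_haar_eq_smul_coneMeasure :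
    ∃ k : NNReal, (Measure.haar : Measure G) = k • coneMeasure := by
  have h := Measure.isMulLeftInvariant_eq_smul coneMeasure (Measure.haar : Measure G)
  generalize coneMeasure.haarScalarFactor (Measure.haar : Measure G) = k at h
  have hk : k ≠ 0 := by
    rintro rfl
    rw [zero_smul] at h
    exact coneMeasure_ne_zero h
  refine ⟨k⁻¹, ?_⟩
  rw [h, smul_smul, inv_mul_cancel₀ hk, one_smul]

/-! ### Disintegration of Haar measure over the first two rows. -/

theorem measurable_vec3 {X : Type*} [MeasurableSpace X] :
    Measurable fun p : X × X × X => (![p.1, p.2.1, p.2.2] : Fin 3 → X) := by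
  refine measurable_pi_iff.2 fun i => ?_
  fin_cases i
  · exact measurable_fst
  · exact measurable_fst.comp measurable_snd
  · exact measurable_snd.comp measurable_snd

theorem lintegral_fin_three {X : Type*} [MeasureSpace X] [SigmaFinite (volume : Measure X)]
    {f : (Fin 3 → X) → ℝ≥0∞} (hf : Measurable f) :
    ∫⁻ x, f x = ∫⁻ a, ∫⁻ b, ∫⁻ c, f ![a, b, c] := by
  have h1 := (volume_preserving_piFinSuccAbove (fun _ : Fin 3 => X) 0).symm
  have h2 := ((MeasurePreserving.id (volume : Measure X)).prod
    (volume_preserving_finTwoArrow X).symm)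
  have h3 := h1.comp h2
  have h4 : (MeasurableEquiv.piFinSuccAbove (fun _ : Fin 3 => X) 0).symm ∘
      (Prod.map id (MeasurableEquiv.finTwoArrow (α := X)).symm) =
      fun p : X × X × X => (![p.1, p.2.1, p.2.2] : Fin 3 → X) := by
    funext p
    ext i
    fin_cases i <;> rfl
  rw [h4] at h3
  rw [← h3.lintegral_comp hf]
  have hm : Measurable fun p : X × X × X => f ![p.1, p.2.1, p.2.2] := hf.comp measurable_vec3
  change ∫⁻ p, f ![p.1, p.2.1, p.2.2] ∂(volume.prod (volume.prod volume)) = _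
  rw [lintegral_prod _ hm.aemeasurable]
  refine lintegral_congr fun a => ?_
  exact lintegral_prod _ (hm.comp (measurable_prodMk_left (x := a))).aemeasurable

theorem rowDet_vec (v u w : Fin 3 → ℝ) : rowDet ![v, u, w] = (v ⨯₃ u) ⬝ᵥ w := by
  simp [rowDet_eq, cross_apply, dotProduct, Fin.sum_univ_three]; ring

/-- The coefficient of `w` along `v` in the orthogonal projection to the span of `v` and `u`. -/
def offA (v u w : Fin 3 → ℝ) : ℝ :=
  (u ⨯₃ (v ⨯₃ u)) ⬝ᵥ w / ((v ⨯₃ u) ⬝ᵥ (v ⨯₃ u))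

/-- The coefficient of `w` along `u` in the orthogonal projection to the span of `v` and `u`. -/
def offB (v u w : Fin 3 → ℝ) : ℝ :=
  ((v ⨯₃ u) ⨯₃ v) ⬝ᵥ w / ((v ⨯₃ u) ⬝ᵥ (v ⨯₃ u))

/-- The frame dual to `v`, `u` and the cross product. -/
def dualFrame (v u : Fin 3 → ℝ) : Matrix (Fin 3) (Fin 3) ℝ :=
  Matrix.of ![(((v ⨯₃ u) ⬝ᵥ (v ⨯₃ u))⁻¹ : ℝ) • (u ⨯₃ (v ⨯₃ u)),
    (((v ⨯₃ u) ⬝ᵥ (v ⨯₃ u))⁻¹ : ℝ) • ((v ⨯₃ u) ⨯₃ v), v ⨯₃ u]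

theorem dualFrame_mulVec (v u w : Fin 3 → ℝ) :
    dualFrame v u *ᵥ w = ![offA v u w, offB v u w, rowDet ![v, u, w]] := by
  rw [rowDet_vec]
  ext i
  fin_cases i
  · change ((((v ⨯₃ u) ⬝ᵥ (v ⨯₃ u))⁻¹ : ℝ) • (u ⨯₃ (v ⨯₃ u))) ⬝ᵥ w = offA v u w
    rw [smul_dotProduct, offA, div_eq_inv_mul, smul_eq_mul]
  · change ((((v ⨯₃ u) ⬝ᵥ (v ⨯₃ u))⁻¹ : ℝ) • ((v ⨯₃ u) ⨯₃ v)) ⬝ᵥ w = offB v u w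
    rw [smul_dotProduct, offB, div_eq_inv_mul, smul_eq_mul]
  · simp [dualFrame, mulVec]

/-- The first two rows of the frame are dual to `v`, `u` within their plane. Determinant one is what
makes passing from `w` to its offsets and determinant volume preserving. -/
theorem det_dualFrame {v u : Fin 3 → ℝ} (h : v ⨯₃ u ≠ 0) : (dualFrame v u).det = 1 := by
  have hN : (v ⨯₃ u) ⬝ᵥ (v ⨯₃ u) ≠ 0 := by simpa [dotProduct_self_eq_zero] using h
  have h1 : v ⬝ᵥ (v ⨯₃ u) = 0 := dot_self_cross v u
  have h2 : u ⬝ᵥ (v ⨯₃ u) = 0 := dot_cross_self v u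
  have h3 : (v ⨯₃ u) ⬝ᵥ (v ⨯₃ u) = rowDet ![v, u, v ⨯₃ u] := (rowDet_vec _ _ _).symm
  generalize hn : v ⨯₃ u = n at *
  have key : n ⬝ᵥ ((u ⨯₃ n) ⨯₃ (n ⨯₃ v)) = (n ⬝ᵥ n) ^ 2 := by
    have e : n ⬝ᵥ ((u ⨯₃ n) ⨯₃ (n ⨯₃ v)) = (n ⬝ᵥ n) * rowDet ![v, u, n] := by
      simp [rowDet_eq, cross_apply, dotProduct, Fin.sum_univ_three]; ring
    rw [e, ← h3, sq]
  have e2 : (dualFrame v u).det = (n ⬝ᵥ n)⁻¹ ^ 2 * (n ⬝ᵥ ((u ⨯₃ n) ⨯₃ (n ⨯₃ v))) := by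
    simp only [dualFrame, hn]
    generalize (n ⬝ᵥ n)⁻¹ = c
    simp [det_fin_three, cross_apply, dotProduct, Fin.sum_univ_three]; ring
  rw [e2, key]
  field_simp

theorem lintegral_comp_mulVec {A : Matrix (Fin 3) (Fin 3) ℝ} (hA : A.det ≠ 0)
    {f : (Fin 3 → ℝ) → ℝ≥0∞} (hf : Measurable f) :
    ∫⁻ w, f (A *ᵥ w) = ENNReal.ofReal |A.det⁻¹| * ∫⁻ w, f w := by
  have h := Real.map_matrix_volume_pi_eq_smul_volume_pi hA
  rw [← smul_eq_mul, ← lintegral_smul_measure, ← h, lintegral_map hf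
    (Matrix.toLin' A).continuous_of_finiteDimensional.measurable]
  rfl

/-- The map sending a third row to its offsets and its determinant preserves Lebesgue measure. -/
theorem lintegral_cell_section {v u : Fin 3 → ℝ} (h : v ⨯₃ u ≠ 0) {φ : ℝ → ℝ≥0∞}
    (hφ : Measurable φ) :
    ∫⁻ w, ((Set.Ico (0 : ℝ) 1).indicator 1 (offA v u w) *
      (Set.Ico (0 : ℝ) 1).indicator 1 (offB v u w) *
      (Set.Ioc (0 : ℝ) 1).indicator φ (rowDet ![v, u, w]) : ℝ≥0∞) = ∫⁻ t in Set.Ioc (0 : ℝ) 1, φ t := by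
  have hI : Measurable ((Set.Ico (0 : ℝ) 1).indicator (1 : ℝ → ℝ≥0∞)) :=
    measurable_one.indicator measurableSet_Ico
  have hJ : Measurable ((Set.Ioc (0 : ℝ) 1).indicator φ) := hφ.indicator measurableSet_Ioc
  let f : (Fin 3 → ℝ) → ℝ≥0∞ := fun x => (Set.Ico (0 : ℝ) 1).indicator 1 (x 0) *
      (Set.Ico (0 : ℝ) 1).indicator 1 (x 1) * (Set.Ioc (0 : ℝ) 1).indicator φ (x 2)
  have hf : Measurable f := ((hI.comp (measurable_pi_apply 0)).mul
    (hI.comp (measurable_pi_apply 1))).mul (hJ.comp (measurable_pi_apply 2))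
  have h1 := lintegral_comp_mulVec (A := dualFrame v u) (by simp [det_dualFrame h]) hf
  rw [det_dualFrame h] at h1
  simp only [dualFrame_mulVec] at h1
  calc _ = ∫⁻ w, f ![offA v u w, offB v u w, rowDet ![v, u, w]] := rfl
    _ = ∫⁻ w, f w := by rw [h1]; simp
    _ = _ := by
      rw [lintegral_fin_three hf]
      have h3 : ∫⁻ t, (Set.Ioc (0 : ℝ) 1).indicator φ t = ∫⁻ t in Set.Ioc (0 : ℝ) 1, φ t :=
        lintegral_indicator measurableSet_Ioc _
      have h4 : ∫⁻ t, (Set.Ico (0 : ℝ) 1).indicator (1 : ℝ → ℝ≥0∞) t = 1 := by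
        rw [lintegral_indicator_one measurableSet_Ico]; simp
      calc _ = ∫⁻ a, ∫⁻ b, (Set.Ico (0 : ℝ) 1).indicator (1 : ℝ → ℝ≥0∞) a *
            (Set.Ico (0 : ℝ) 1).indicator (1 : ℝ → ℝ≥0∞) b * ∫⁻ t in Set.Ioc (0 : ℝ) 1, φ t := by
            refine lintegral_congr fun a => lintegral_congr fun b => ?_
            rw [← h3, ← lintegral_const_mul _ hJ]
            rfl
        _ = ∫⁻ a, (Set.Ico (0 : ℝ) 1).indicator (1 : ℝ → ℝ≥0∞) a *
            ∫⁻ t in Set.Ioc (0 : ℝ) 1, φ t := by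
            refine lintegral_congr fun a => ?_
            rw [lintegral_mul_const _ (hI.const_mul _), lintegral_const_mul _ hI, h4,
              mul_one]
        _ = _ := by rw [lintegral_mul_const _ hI, h4, one_mul]

theorem cross_smul_smul (s : ℝ) (v u : Fin 3 → ℝ) : (s • v) ⨯₃ (s • u) = (s ^ 2) • (v ⨯₃ u) := by
  rw [map_smul, map_smul, LinearMap.smul_apply, smul_smul, sq]

theorem offA_smul {s : ℝ} (hs : s ≠ 0) (v u w : Fin 3 → ℝ) :
    offA (s • v) (s • u) (s • w) = offA v u w := by
  unfold offA
  rw [cross_smul_smul]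
  simp only [map_smul, LinearMap.smul_apply, smul_dotProduct, dotProduct_smul, smul_eq_mul]
  by_cases hN : (v ⨯₃ u) ⬝ᵥ (v ⨯₃ u) = 0
  · simp [hN]
  · field_simp

theorem offB_smul {s : ℝ} (hs : s ≠ 0) (v u w : Fin 3 → ℝ) :
    offB (s • v) (s • u) (s • w) = offB v u w := by
  unfold offB
  rw [cross_smul_smul]
  simp only [map_smul, LinearMap.smul_apply, smul_dotProduct, dotProduct_smul, smul_eq_mul]
  by_cases hN : (v ⨯₃ u) ⬝ᵥ (v ⨯₃ u) = 0
  · simp [hN]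
  · field_simp

theorem measurable_offA :
    Measurable fun M : Fin 3 → Fin 3 → ℝ => offA (M 0) (M 1) (M 2) := by
  simp only [offA, cross_apply, dotProduct, Fin.sum_univ_three, Matrix.cons_val]
  fun_prop

theorem measurable_offB :
    Measurable fun M : Fin 3 → Fin 3 → ℝ => offB (M 0) (M 1) (M 2) := by
  simp only [offB, cross_apply, dotProduct, Fin.sum_univ_three, Matrix.cons_val]
  fun_prop

/-- Elements of `SL₃(ℝ)` whose last row has reduced offsets. -/
def cell : Set G := {g | offA (rows g 0) (rows g 1) (rows g 2) ∈ Set.Ico (0 : ℝ) 1 ∧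
  offB (rows g 0) (rows g 1) (rows g 2) ∈ Set.Ico (0 : ℝ) 1}

theorem measurableSet_cell : MeasurableSet cell :=
  ((measurable_offA.comp measurable_rows) measurableSet_Ico).inter
    ((measurable_offB.comp measurable_rows) measurableSet_Ico)

theorem ae_cross_ne_zero : ∀ᵐ v : Fin 3 → ℝ, ∀ᵐ u : Fin 3 → ℝ, v ⨯₃ u ≠ 0 := by
  have h0 : ∀ᵐ v : Fin 3 → ℝ, v ≠ 0 := by simp [ae_iff]
  filter_upwards [h0] with v hv
  have hs : LinearMap.ker (crossProduct v) ≠ ⊤ := by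
    intro h
    rw [LinearMap.ker_eq_top] at h
    apply hv
    have h1 := congrFun (LinearMap.congr_fun h ![1, 0, 0])
    have h2 := congrFun (LinearMap.congr_fun h ![0, 1, 0])
    simp only [cross_apply, LinearMap.zero_apply, Pi.zero_apply] at h1 h2
    have a := h1 1
    have b := h1 2
    have c := h2 2
    simp at a b c
    ext i; fin_cases i <;> simp [a, b, c]
  have := Measure.addHaar_submodule volume _ hs
  rw [ae_iff]
  convert! this using 2
  ext u; simp

theorem lintegral_comp_smul_eq {E : Type*} [NormedAddCommGroup E] [NormedSpace ℝ E]
    [MeasurableSpace E] [BorelSpace E] [FiniteDimensional ℝ E] (ν : Measure E)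
    [ν.IsAddHaarMeasure] {r : ℝ} (hr : r ≠ 0) {f : E → ℝ≥0∞} (hf : Measurable f) :
    ∫⁻ x, f (r • x) ∂ν = ENNReal.ofReal |(r ^ Module.finrank ℝ E)⁻¹| * ∫⁻ x, f x ∂ν := by
  rw [← smul_eq_mul, ← lintegral_smul_measure, ← Measure.map_addHaar_smul ν hr,
    lintegral_map hf (measurable_const_smul r)]

/-- For fixed `v, u`, the third row is replaced by two offsets in `[0, 1)` and the determinant `t ∈
(0, 1]`. For fixed `t`, undoing the scaling of `(v, u)` by `t ^ (-1/3)` in dimension six gives the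
factor under the integral over `t`. -/
theorem lintegral_cell_coneMeasure {H : (Fin 3 → ℝ) × (Fin 3 → ℝ) → ℝ≥0∞} (hH : Measurable H) :
    ∫⁻ g in cell, H (rows g 0, rows g 1) ∂coneMeasure =
      (∫⁻ t in Set.Ioc (0 : ℝ) 1, ENNReal.ofReal |((t ^ (-1 / 3 : ℝ)) ^ 6)⁻¹|) * ∫⁻ p, H p := by
  have hI : Measurable ((Set.Ico (0 : ℝ) 1).indicator (1 : ℝ → ℝ≥0∞)) :=
    measurable_one.indicator measurableSet_Ico
  have hmr : Measurable fun g : G => H (rows g 0, rows g 1) :=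
    hH.comp (((measurable_pi_apply 0).comp measurable_rows).prodMk
      ((measurable_pi_apply 1).comp measurable_rows))
  have hsc : Measurable fun q : ((Fin 3 → ℝ) × (Fin 3 → ℝ)) × ℝ =>
      H ((q.2 ^ (-1 / 3 : ℝ)) • q.1) :=
    hH.comp ((measurable_snd.pow_const _).smul measurable_fst)
  let K : (Fin 3 → Fin 3 → ℝ) → ℝ≥0∞ := fun M =>
    (Set.Ico (0 : ℝ) 1).indicator 1 (offA (M 0) (M 1) (M 2)) *
      (Set.Ico (0 : ℝ) 1).indicator 1 (offB (M 0) (M 1) (M 2)) *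
      (Set.Ioc (0 : ℝ) 1).indicator (fun t => H ((t ^ (-1 / 3 : ℝ)) • (M 0, M 1))) (rowDet M)
  have hK : Measurable K := by
    refine ((hI.comp measurable_offA).mul (hI.comp measurable_offB)).mul ?_
    have : (fun M : Fin 3 → Fin 3 → ℝ => (Set.Ioc (0 : ℝ) 1).indicator
        (fun t => H ((t ^ (-1 / 3 : ℝ)) • (M 0, M 1))) (rowDet M)) =
        cone.indicator fun M => H ((rowDet M ^ (-1 / 3 : ℝ)) • (M 0, M 1)) := by
      funext M
      by_cases h : M ∈ cone
      · rw [Set.indicator_of_mem h, Set.indicator_of_mem (show rowDet M ∈ Set.Ioc (0 : ℝ) 1 from h)]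
      · rw [Set.indicator_of_notMem h,
          Set.indicator_of_notMem (show rowDet M ∉ Set.Ioc (0 : ℝ) 1 from h)]
    rw [this]
    refine Measurable.indicator ?_ measurableSet_cone
    exact hsc.comp (((measurable_pi_apply 0).prodMk (measurable_pi_apply 1)).prodMk
      continuous_rowDet.measurable)
  have e1 : ∫⁻ g in cell, H (rows g 0, rows g 1) ∂coneMeasure = ∫⁻ M, K M := by
    rw [← lintegral_indicator measurableSet_cell,
      lintegral_coneMeasure (hmr.indicator measurableSet_cell),
      ← lintegral_indicator measurableSet_cone]
    refine lintegral_congr fun M => ?_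
    by_cases hM : M ∈ cone
    · have hs : (rowDet M ^ (-1 / 3 : ℝ)) ≠ 0 := (Real.rpow_pos_of_pos hM.1 _).ne'
      have hc : coneProj M ∈ cell ↔ offA (M 0) (M 1) (M 2) ∈ Set.Ico (0 : ℝ) 1 ∧
          offB (M 0) (M 1) (M 2) ∈ Set.Ico (0 : ℝ) 1 := by
        simp only [cell, Set.mem_ofPred_eq, rows_coneProj hM.1, Pi.smul_apply, offA_smul hs,
          offB_smul hs]
      rw [Set.indicator_of_mem hM]
      simp only [K]
      rw [Set.indicator_of_mem (show rowDet M ∈ Set.Ioc (0 : ℝ) 1 from hM)]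
      by_cases h1 : offA (M 0) (M 1) (M 2) ∈ Set.Ico (0 : ℝ) 1
      · by_cases h2 : offB (M 0) (M 1) (M 2) ∈ Set.Ico (0 : ℝ) 1
        · rw [Set.indicator_of_mem (hc.2 ⟨h1, h2⟩), Set.indicator_of_mem h1,
            Set.indicator_of_mem h2, rows_coneProj hM.1]
          simp
        · rw [Set.indicator_of_notMem (fun h => h2 (hc.1 h).2), Set.indicator_of_notMem h2]
          simp
      · rw [Set.indicator_of_notMem (fun h => h1 (hc.1 h).1), Set.indicator_of_notMem h1]
        simp
    · rw [Set.indicator_of_notMem hM]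
      simp only [K]
      rw [Set.indicator_of_notMem (show rowDet M ∉ Set.Ioc (0 : ℝ) 1 from hM), mul_zero]
  have e2 : ∫⁻ M, K M = ∫⁻ v, ∫⁻ u, ∫⁻ t in Set.Ioc (0 : ℝ) 1,
      H ((t ^ (-1 / 3 : ℝ)) • (v, u)) := by
    rw [lintegral_fin_three hK]
    refine lintegral_congr_ae ?_
    filter_upwards [ae_cross_ne_zero] with v hv
    refine lintegral_congr_ae ?_
    filter_upwards [hv] with u hu
    exact lintegral_cell_section hu (φ := fun t => H ((t ^ (-1 / 3 : ℝ)) • (v, u)))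
      (hsc.comp (measurable_prodMk_left (x := (v, u))))
  have e3 : ∫⁻ v, ∫⁻ u, ∫⁻ t in Set.Ioc (0 : ℝ) 1, H ((t ^ (-1 / 3 : ℝ)) • (v, u)) =
      ∫⁻ p : (Fin 3 → ℝ) × (Fin 3 → ℝ), ∫⁻ t in Set.Ioc (0 : ℝ) 1,
        H ((t ^ (-1 / 3 : ℝ)) • p) := by
    rw [Measure.volume_eq_prod, lintegral_prod _ (hsc.lintegral_prod_right').aemeasurable]
  rw [e1, e2, e3, lintegral_lintegral_swap hsc.aemeasurable,
    ← lintegral_mul_const _ (by fun_prop)]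
  refine setLIntegral_congr_fun measurableSet_Ioc fun t ht => ?_
  have hs : (t ^ (-1 / 3 : ℝ)) ≠ 0 := (Real.rpow_pos_of_pos ht.1 _).ne'
  change ∫⁻ p : (Fin 3 → ℝ) × (Fin 3 → ℝ), H ((t ^ (-1 / 3 : ℝ)) • p) = _
  have : (volume : Measure ((Fin 3 → ℝ) × (Fin 3 → ℝ))).IsAddHaarMeasure :=
    Measure.prod.instIsAddHaarMeasure (volume : Measure (Fin 3 → ℝ)) (volume : Measure (Fin 3 → ℝ))
  rw [lintegral_comp_smul_eq _ hs hH]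
  simp

/-- Integration over the cell of a function of the first two rows. -/
theorem exists_lintegral_cell : ∃ C : NNReal, ∀ H : (Fin 3 → ℝ) × (Fin 3 → ℝ) → ℝ≥0∞,
    Measurable H → ∫⁻ g in cell, H (rows g 0, rows g 1) ∂(Measure.haar : Measure G) =
      C * ∫⁻ p, H p := by
  obtain ⟨k, hk⟩ := exists_haar_eq_smul_coneMeasure
  have hfin : (∫⁻ t in Set.Ioc (0 : ℝ) 1, ENNReal.ofReal |((t ^ (-1 / 3 : ℝ)) ^ 6)⁻¹|) ≠ ∞ := by
    refine ne_top_of_le_ne_top (b := ∫⁻ t in Set.Ioc (0 : ℝ) 1, 1) (by simp) ?_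
    refine setLIntegral_mono' measurableSet_Ioc fun t ht => ?_
    rw [← ENNReal.ofReal_one]
    have h1 : 1 ≤ t ^ (-1 / 3 : ℝ) :=
      Real.one_le_rpow_of_pos_of_le_one_of_nonpos ht.1 ht.2 (by norm_num)
    refine ENNReal.ofReal_le_ofReal ?_
    rw [abs_of_nonneg (by positivity)]
    exact inv_le_one_of_one_le₀ (one_le_pow₀ h1)
  refine ⟨k * (∫⁻ t in Set.Ioc (0 : ℝ) 1, ENNReal.ofReal |((t ^ (-1 / 3 : ℝ)) ^ 6)⁻¹|).toNNReal,
    fun H hH => ?_⟩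
  rw [hk, Measure.restrict_smul, lintegral_smul_measure, lintegral_cell_coneMeasure hH,
    ENNReal.coe_mul, ENNReal.coe_toNNReal hfin, mul_assoc]
  rfl

/-! ### Lattice points and Hermite normal form. -/

/-- The point of `ℤ³ g` with coordinates `n`. -/
def latPt (n : Fin 3 → ℤ) (g : G) : Fin 3 → ℝ := (fun i => (n i : ℝ)) ᵥ* g.1

theorem latPt_eq (n : Fin 3 → ℤ) (g : G) :
    latPt n g = (n 0 : ℝ) • rows g 0 + (n 1 : ℝ) • rows g 1 + (n 2 : ℝ) • rows g 2 := by
  ext j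
  simp [latPt, rows, vecMul, dotProduct, Fin.sum_univ_three]

/-- The inclusion of `SL₃(ℤ)` in `SL₃(ℝ)`, with image `Γ`. -/
def ofInt (δ : Matrix.SpecialLinearGroup (Fin 3) ℤ) : Γ :=
  ⟨Matrix.SpecialLinearGroup.map (n := Fin 3) (Int.castRingHom ℝ) δ, δ, rfl⟩

theorem ofInt_surjective : Function.Surjective ofInt := by
  rintro ⟨_, δ, rfl⟩; exact ⟨δ, rfl⟩

theorem ofInt_mul (δ ε : Matrix.SpecialLinearGroup (Fin 3) ℤ) :
    ofInt (δ * ε) = ofInt δ * ofInt ε := Subtype.ext (map_mul _ _ _)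

theorem ofInt_smul (δ : Matrix.SpecialLinearGroup (Fin 3) ℤ) (g : G) :
    ofInt δ • g = (ofInt δ : G) * g := rfl

theorem rows_ofInt_smul (δ : Matrix.SpecialLinearGroup (Fin 3) ℤ) (g : G) (i : Fin 3) :
    rows (ofInt δ • g) i = latPt (δ.1 i) g := rfl

theorem latPt_ofInt_smul (n : Fin 3 → ℤ) (δ : Matrix.SpecialLinearGroup (Fin 3) ℤ) (g : G) :
    latPt n (ofInt δ • g) = latPt (n ᵥ* δ.1) g := by
  ext j
  simp only [latPt_eq, rows_ofInt_smul]
  simp [vecMul, dotProduct, Fin.sum_univ_three]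
  ring

theorem cross_rows (g : G) : (rows g 0 ⨯₃ rows g 1) ⬝ᵥ rows g 2 = 1 := by
  rw [← rowDet_vec, ← rowDet_rows g]
  congr 1
  ext i j; fin_cases i <;> rfl

theorem cross_rows_ne_zero (g : G) : rows g 0 ⨯₃ rows g 1 ≠ 0 := by
  intro h
  have := cross_rows g
  simp [h] at this

theorem offA_add {v u : Fin 3 → ℝ} (h : v ⨯₃ u ≠ 0) (w : Fin 3 → ℝ) (r s : ℝ) :
    offA v u (r • v + s • u + w) = r + offA v u w := by
  have hN : (v ⨯₃ u) ⬝ᵥ (v ⨯₃ u) ≠ 0 := by simpa [dotProduct_self_eq_zero] using h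
  have h1 : (u ⨯₃ (v ⨯₃ u)) ⬝ᵥ v = (v ⨯₃ u) ⬝ᵥ (v ⨯₃ u) := by
    simp [cross_apply, dotProduct, Fin.sum_univ_three]; ring
  have h2 : (u ⨯₃ (v ⨯₃ u)) ⬝ᵥ u = 0 := by rw [dotProduct_comm, dot_self_cross]
  simp only [offA, dotProduct_add, dotProduct_smul, h1, h2, smul_eq_mul]
  field_simp
  ring

theorem offB_add {v u : Fin 3 → ℝ} (h : v ⨯₃ u ≠ 0) (w : Fin 3 → ℝ) (r s : ℝ) :
    offB v u (r • v + s • u + w) = s + offB v u w := by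
  have hN : (v ⨯₃ u) ⬝ᵥ (v ⨯₃ u) ≠ 0 := by simpa [dotProduct_self_eq_zero] using h
  have h1 : ((v ⨯₃ u) ⨯₃ v) ⬝ᵥ u = (v ⨯₃ u) ⬝ᵥ (v ⨯₃ u) := by
    simp [cross_apply, dotProduct, Fin.sum_univ_three]; ring
  have h2 : ((v ⨯₃ u) ⨯₃ v) ⬝ᵥ v = 0 := by rw [dotProduct_comm, dot_cross_self]
  simp only [offB, dotProduct_add, dotProduct_smul, h1, h2, smul_eq_mul]
  field_simp
  ring

theorem vecMul_mul_val (x : Fin 3 → ℤ) (δ ε : Matrix.SpecialLinearGroup (Fin 3) ℤ) :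
    x ᵥ* (δ * ε).1 = (x ᵥ* δ.1) ᵥ* ε.1 := (vecMul_vecMul x δ.1 ε.1).symm

theorem exists_gcd_row (x y : ℤ) : ∃ (k : Matrix.SpecialLinearGroup (Fin 2) ℤ) (d : ℕ),
    x = d * k.1 0 0 ∧ y = d * k.1 0 1 := by
  by_cases h : x = 0 ∧ y = 0
  · exact ⟨1, 0, by simp [h.1], by simp [h.2]⟩
  · have hg : 0 < Int.gcd x y := Int.gcd_pos_iff.2 (by tauto)
    have hc : IsCoprime (x / Int.gcd x y) (y / Int.gcd x y) :=
      Int.isCoprime_iff_gcd_eq_one.2 (Int.gcd_ediv_gcd_ediv_gcd hg)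
    obtain ⟨k, h0, h1⟩ := hc.exists_SL2_row 0
    refine ⟨k, Int.gcd x y, ?_, ?_⟩
    · rw [h0, Int.mul_ediv_cancel' (Int.gcd_dvd_left ..)]
    · rw [h1, Int.mul_ediv_cancel' (Int.gcd_dvd_right ..)]

/-- `SL₂(ℤ)` acting on the last two coordinates. -/
def blockLower (k : Matrix.SpecialLinearGroup (Fin 2) ℤ) : Matrix.SpecialLinearGroup (Fin 3) ℤ :=
  ⟨!![1, 0, 0; 0, k.1 0 0, k.1 0 1; 0, k.1 1 0, k.1 1 1], by
    have := k.2
    rw [det_fin_two] at this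
    simp [det_fin_three]
    linarith⟩

/-- `SL₂(ℤ)` acting on the first two coordinates. -/
def blockUpper (k : Matrix.SpecialLinearGroup (Fin 2) ℤ) : Matrix.SpecialLinearGroup (Fin 3) ℤ :=
  ⟨!![k.1 0 0, k.1 0 1, 0; k.1 1 0, k.1 1 1, 0; 0, 0, 1], by
    have := k.2
    rw [det_fin_two] at this
    simp [det_fin_three]
    linarith⟩

/-- The lower unitriangular matrices of `SL₃(ℤ)`. -/
def unip (m r s : ℤ) : Matrix.SpecialLinearGroup (Fin 3) ℤ :=
  ⟨!![1, 0, 0; m, 1, 0; r, s, 1], by simp [det_fin_three]⟩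

theorem vecMul_blockLower (x : Fin 3 → ℤ) (k : Matrix.SpecialLinearGroup (Fin 2) ℤ) :
    x ᵥ* (blockLower k).1 = ![x 0, x 1 * k.1 0 0 + x 2 * k.1 1 0, x 1 * k.1 0 1 + x 2 * k.1 1 1] := by
  ext i
  fin_cases i <;> simp [vecMul, dotProduct, Fin.sum_univ_three, blockLower]

theorem vecMul_blockUpper (x : Fin 3 → ℤ) (k : Matrix.SpecialLinearGroup (Fin 2) ℤ) :
    x ᵥ* (blockUpper k).1 = ![x 0 * k.1 0 0 + x 1 * k.1 1 0, x 0 * k.1 0 1 + x 1 * k.1 1 1, x 2] := by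
  ext i
  fin_cases i <;> simp [vecMul, dotProduct, Fin.sum_univ_three, blockUpper]

theorem vecMul_unip (x : Fin 3 → ℤ) (m r s : ℤ) :
    x ᵥ* (unip m r s).1 = ![x 0 + x 1 * m + x 2 * r, x 1 + x 2 * s, x 2] := by
  ext i
  fin_cases i <;> simp [vecMul, dotProduct, Fin.sum_univ_three, unip]

/-- Two gcd steps: the last two coordinates merge into `d`, then `p 0` and `d` merge into `a`. -/
theorem exists_vecMul_first (p : Fin 3 → ℤ) :
    ∃ (δ : Matrix.SpecialLinearGroup (Fin 3) ℤ) (a : ℕ), p = ![(a : ℤ), 0, 0] ᵥ* δ.1 := by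
  obtain ⟨k, d, h1, h2⟩ := exists_gcd_row (p 1) (p 2)
  obtain ⟨l, a, h3, h4⟩ := exists_gcd_row (p 0) d
  refine ⟨blockUpper l * blockLower k, a, ?_⟩
  rw [vecMul_mul_val, vecMul_blockUpper, vecMul_blockLower]
  ext i
  fin_cases i
  · simp [h3]
  · simp [h1, ← h4]
  · simp [h2, ← h4]

/-- Once `p` lies on the first axis, `blockLower` fixes that axis and can clear the third coordinate
of `q` without disturbing `p`. -/
theorem exists_hermite (p q : Fin 3 → ℤ) :
    ∃ (δ : Matrix.SpecialLinearGroup (Fin 3) ℤ) (a d : ℕ) (b : ℤ),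
      p = ![(a : ℤ), 0, 0] ᵥ* δ.1 ∧ q = ![b, (d : ℤ), 0] ᵥ* δ.1 := by
  obtain ⟨δ, a, hp⟩ := exists_vecMul_first p
  set x : Fin 3 → ℤ := q ᵥ* (δ⁻¹).1 with hx
  have hq : q = x ᵥ* δ.1 := by
    rw [hx, ← vecMul_mul_val, inv_mul_cancel]
    exact (vecMul_one q).symm
  obtain ⟨k, d, h1, h2⟩ := exists_gcd_row (x 1) (x 2)
  refine ⟨blockLower k * δ, a, d, x 0, ?_, ?_⟩
  · rw [vecMul_mul_val, vecMul_blockLower, hp]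
    congr 1
    simp
  · rw [vecMul_mul_val, vecMul_blockLower, hq]
    congr 1
    ext i
    fin_cases i <;> simp [h1, h2]

theorem rows_unip_smul_zero (r s : ℤ) (g : G) :
    rows (ofInt (unip 0 r s) • g) 0 = rows g 0 := by
  rw [rows_ofInt_smul, latPt_eq]; simp [unip]

theorem exists_unip_smul_mem_cell (g : G) : ∃ r s : ℤ, ofInt (unip 0 r s) • g ∈ cell := by
  obtain ⟨r, hr⟩ : ∃ r, r = -⌊offA (rows g 0) (rows g 1) (rows g 2)⌋ := ⟨_, rfl⟩
  obtain ⟨s, hs⟩ : ∃ s, s = -⌊offB (rows g 0) (rows g 1) (rows g 2)⌋ := ⟨_, rfl⟩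
  refine ⟨r, s, ?_⟩
  have e1 : rows (ofInt (unip 0 r s) • g) 1 = rows g 1 := by
    rw [rows_ofInt_smul, latPt_eq]; simp [unip]
  have e2 : rows (ofInt (unip 0 r s) • g) 2 = (r : ℝ) • rows g 0 +
      (s : ℝ) • rows g 1 + rows g 2 := by
    rw [rows_ofInt_smul, latPt_eq]; simp [unip]
  have hne := cross_rows_ne_zero g
  simp only [cell, Set.mem_ofPred_eq, rows_unip_smul_zero, e1, e2, offA_add hne, offB_add hne]
  simp only [hr, hs, Int.cast_neg, neg_add_eq_sub, Int.self_sub_floor, Set.mem_Ico, Int.fract_nonneg, Int.fract_lt_one, and_self]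

/-- Every linearly independent pair of lattice vectors has a Hermite normal form with respect to
the first two rows of a translate in the cell. -/
theorem exists_hermite_cell (g : G) (p q : Fin 3 → ℤ) (h : latPt p g ⨯₃ latPt q g ≠ 0) :
    ∃ (δ : Matrix.SpecialLinearGroup (Fin 3) ℤ) (a d : ℕ) (b : Fin (d + 1)), ofInt δ • g ∈ cell ∧
      p = ![((a + 1 : ℕ) : ℤ), 0, 0] ᵥ* δ.1 ∧ q = ![((b : ℕ) : ℤ), ((d + 1 : ℕ) : ℤ), 0] ᵥ* δ.1 := by
  obtain ⟨δ, a, d, c, hp, hq⟩ := exists_hermite p q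
  have ha : a ≠ 0 := by
    rintro rfl
    have : p = 0 := by rw [hp]; ext i; simp [vecMul, dotProduct, Fin.sum_univ_three]
    apply h
    rw [this]
    simp [latPt_eq]
  have hd : d ≠ 0 := by
    rintro rfl
    apply h
    rw [hp, hq, ← latPt_ofInt_smul, ← latPt_ofInt_smul]
    simp [latPt_eq]
  obtain ⟨a, rfl⟩ := Nat.exists_eq_succ_of_ne_zero ha
  obtain ⟨d, rfl⟩ := Nat.exists_eq_succ_of_ne_zero hd
  have hd0 : (0 : ℤ) < ((d + 1 : ℕ) : ℤ) := by positivity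
  obtain ⟨b, hb⟩ := Int.eq_ofNat_of_zero_le (Int.emod_nonneg c hd0.ne')
  have hb1 : b < d + 1 := by
    have := Int.emod_lt_of_pos c hd0
    rw [hb] at this
    exact_mod_cast this
  have hc : c = b + ((d + 1 : ℕ) : ℤ) * (c / ((d + 1 : ℕ) : ℤ)) := by
    conv_lhs => rw [← Int.emod_add_mul_ediv c ((d + 1 : ℕ) : ℤ)]
    rw [hb]
  -- `unip m 0 0` sends `(b, d + 1, 0)` to `(b + (d + 1) m, d + 1, 0)` and fixes the first axis, so
  -- it reduces `c` modulo `d + 1`. The later factor `unip 0 r s` alters only the last row, which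
  -- the pair does not involve.
  set m := c / ((d + 1 : ℕ) : ℤ)
  set ε := unip m 0 0 * δ with hε
  obtain ⟨r, s, hrs⟩ := exists_unip_smul_mem_cell (ofInt ε • g)
  refine ⟨unip 0 r s * ε, a, d, ⟨b, hb1⟩, by rwa [ofInt_mul, mul_smul], ?_, ?_⟩
  · rw [vecMul_mul_val, vecMul_unip, hε, vecMul_mul_val, vecMul_unip, hp]
    simp
  · rw [vecMul_mul_val, vecMul_unip, hε, vecMul_mul_val, vecMul_unip, hq, hc]
    simp

theorem latPt_hermite (g : G) (b d : ℤ) (δ : Matrix.SpecialLinearGroup (Fin 3) ℤ) :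
    latPt (![b, d, 0] ᵥ* δ.1) g = (b : ℝ) • rows (ofInt δ • g) 0 + (d : ℝ) • rows (ofInt δ • g) 1 := by
  rw [← latPt_ofInt_smul, latPt_eq]
  simp

/-- The sum over independent pairs of lattice vectors is at most a sum over Hermite normal forms
and group elements. -/
theorem tsum_indep_le (g : G) (F : (Fin 3 → ℝ) × (Fin 3 → ℝ) → ℝ≥0∞) :
    ∑' x : {x : (Fin 3 → ℤ) × (Fin 3 → ℤ) // latPt x.1 g ⨯₃ latPt x.2 g ≠ 0},
      F (latPt x.1.1 g, latPt x.1.2 g) ≤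
    ∑' A : ℕ × (Σ d : ℕ, Fin (d + 1)), ∑' γ : Γ, cell.indicator (fun h =>
      F (((A.1 + 1 : ℕ) : ℝ) • rows h 0,
        ((A.2.2 : ℕ) : ℝ) • rows h 0 + ((A.2.1 + 1 : ℕ) : ℝ) • rows h 1)) (γ • g) := by
  choose δ a d b hcell hp hq using fun x : {x : (Fin 3 → ℤ) × (Fin 3 → ℤ) //
    latPt x.1 g ⨯₃ latPt x.2 g ≠ 0} => exists_hermite_cell g x.1.1 x.1.2 x.2
  rw [← ENNReal.tsum_prod]
  have hof : Function.Injective ofInt := by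
    intro x y hxy
    have h1 : ∀ i j, ((x.1 i j : ℤ) : ℝ) = y.1 i j := fun i j =>
      congrFun (congrFun (congrArg (fun z : Γ => (z : G).1) hxy) i) j
    ext i j
    exact_mod_cast h1 i j
  -- The pair can be read off from its normal form. Uniqueness of the normal form is not needed,
  -- because only an upper bound is claimed.
  have hinj : Function.Injective fun x : {x : (Fin 3 → ℤ) × (Fin 3 → ℤ) //
      latPt x.1 g ⨯₃ latPt x.2 g ≠ 0} =>
      (((a x, ⟨d x, b x⟩), ofInt (δ x)) : (ℕ × (Σ d : ℕ, Fin (d + 1))) × Γ) := by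
    intro x y hxy
    simp only [Prod.mk.injEq, Sigma.mk.injEq] at hxy
    obtain ⟨⟨h1, h2, h3⟩, h4⟩ := hxy
    have h5 := hof h4
    have h6 : (b x : ℕ) = b y := by
      have : ∀ {m n : ℕ} (_ : m = n) (i : Fin (m + 1)) (j : Fin (n + 1)), i ≍ j → (i : ℕ) = j := by
        rintro m _ rfl i j hij
        rw [eq_of_heq hij]
      exact this h2 _ _ h3
    apply Subtype.ext
    apply Prod.ext
    · rw [hp x, hp y, h1, h5]
    · rw [hq x, hq y, h6, h5, show (((d x + 1 : ℕ)) : ℤ) = ((d y + 1 : ℕ) : ℤ) by rw [h2]]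
  refine le_trans (le_of_eq (tsum_congr fun x => ?_)) (ENNReal.tsum_comp_le_tsum_of_injective hinj _)
  simp only
  rw [Set.indicator_of_mem (hcell x)]
  conv_lhs => rw [hp x, hq x]
  rw [latPt_hermite, latPt_hermite]
  simp


/-! ### Unfolding and the mean over independent pairs. -/

theorem measurable_comp_smul {f : G → ℝ≥0∞} (hf : Measurable f) (γ : Γ) :
    Measurable fun g : G => f (γ • g) := hf.comp (measurable_const_mul (γ : G))

/-- Unfolding: the translates of `fundDomain` under `Γ` tile `G`. -/
theorem lintegral_fundDomain_tsum {f : G → ℝ≥0∞} (hf : Measurable f) :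
    ∫⁻ g in fundDomain, ∑' γ : Γ, f (γ • g) ∂(Measure.haar : Measure G) =
      ∫⁻ g, f g ∂(Measure.haar : Measure G) := by
  rw [lintegral_tsum fun γ : Γ => (measurable_comp_smul hf γ).aemeasurable]
  exact (isFundamentalDomain_fundDomain.lintegral_eq_tsum'' f).symm

/-- The constant that relates Haar measure on the cell to Lebesgue measure on pairs of rows. -/
def cellConst : NNReal := exists_lintegral_cell.choose

theorem lintegral_cell {H : (Fin 3 → ℝ) × (Fin 3 → ℝ) → ℝ≥0∞} (hH : Measurable H) :
    ∫⁻ g in cell, H (rows g 0, rows g 1) ∂(Measure.haar : Measure G) = cellConst * ∫⁻ p, H p :=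
  exists_lintegral_cell.choose_spec H hH

theorem lintegral_fundDomain_cell {H : (Fin 3 → ℝ) × (Fin 3 → ℝ) → ℝ≥0∞} (hH : Measurable H) :
    ∫⁻ g in fundDomain, ∑' γ : Γ, cell.indicator (fun h => H (rows h 0, rows h 1)) (γ • g)
      ∂(Measure.haar : Measure G) = cellConst * ∫⁻ p, H p := by
  have hmr : Measurable fun g : G => H (rows g 0, rows g 1) :=
    hH.comp (((measurable_pi_apply 0).comp measurable_rows).prodMk
      ((measurable_pi_apply 1).comp measurable_rows))
  rw [lintegral_fundDomain_tsum (hmr.indicator measurableSet_cell),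
    lintegral_indicator measurableSet_cell, lintegral_cell hH]

/-- The shear by `b` is a translation in the second variable and costs nothing; the two dilations of
`ℝ³` contribute the cubes. -/
theorem lintegral_triangular {H : (Fin 3 → ℝ) × (Fin 3 → ℝ) → ℝ≥0∞} (hH : Measurable H)
    {a d : ℝ} (ha : 0 < a) (hd : 0 < d) (b : ℝ) :
    ∫⁻ p : (Fin 3 → ℝ) × (Fin 3 → ℝ), H (a • p.1, b • p.1 + d • p.2) =
      ENNReal.ofReal (1 / a ^ 3) * ENNReal.ofReal (1 / d ^ 3) * ∫⁻ p, H p := by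
  have hm : Measurable fun p : (Fin 3 → ℝ) × (Fin 3 → ℝ) => H (a • p.1, b • p.1 + d • p.2) :=
    hH.comp (by fun_prop)
  rw [Measure.volume_eq_prod, lintegral_prod _ hm.aemeasurable, lintegral_prod _ hH.aemeasurable]
  have h1 : ∀ v : Fin 3 → ℝ, ∫⁻ u, H (a • v, b • v + d • u) =
      ENNReal.ofReal (1 / d ^ 3) * ∫⁻ u, H (a • v, u) := by
    intro v
    have hv : Measurable fun u => H (a • v, u) := hH.comp measurable_prodMk_left
    rw [lintegral_comp_smul_eq volume hd.ne' (f := fun u => H (a • v, b • v + u))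
      (hv.comp (measurable_const_add _)),
      lintegral_add_left_eq_self (fun u => H (a • v, u)) (b • v)]
    simp [abs_of_pos hd]
  have h2 : Measurable fun v => ∫⁻ u, H (v, u) := hH.lintegral_prod_right'
  simp_rw [h1]
  have h3 : Measurable fun v => ∫⁻ u, H (a • v, u) := h2.comp (measurable_const_smul a)
  rw [lintegral_const_mul _ h3,
    lintegral_comp_smul_eq volume ha.ne' (f := fun v => ∫⁻ u, H (v, u)) h2]
  simp only [Module.finrank_fin_fun, abs_of_pos (inv_pos.2 (pow_pos ha 3)), one_div]
  ring

theorem tsum_sq_le : ∑' d : ℕ, ENNReal.ofReal (1 / ((d + 1 : ℕ) : ℝ) ^ 2) ≤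
    ENNReal.ofReal (Real.pi ^ 2 / 6) := by
  have h := (hasSum_nat_add_iff' 1).2 hasSum_zeta_two
  simp only [Finset.range_one, Finset.sum_singleton, Nat.cast_zero] at h
  rw [← ENNReal.ofReal_tsum_of_nonneg (fun _ => by positivity) h.summable, h.tsum_eq]
  simp

theorem tsum_cube_le : ∑' a : ℕ, ENNReal.ofReal (1 / ((a + 1 : ℕ) : ℝ) ^ 3) ≤
    ENNReal.ofReal (5 / 4) := by
  refine ENNReal.tsum_le_of_sum_range_le fun n => ?_
  rw [← ENNReal.ofReal_sum_of_nonneg fun _ _ => by positivity]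
  refine ENNReal.ofReal_le_ofReal ?_
  rcases n with _ | n
  · norm_num
  -- Telescoping with `k = n + 2`: `1/k³ ≤ 1/((k-1)k(k+1))`, which is half of `1/((k-1)k) -
  -- 1/(k(k+1))`. The bound is an equality at `n = 0`, which fixes the constant `5/4`.
  · have h : ∀ n : ℕ, ∑ i ∈ Finset.range (n + 1), 1 / ((i + 1 : ℕ) : ℝ) ^ 3 ≤
        5 / 4 - 1 / (2 * ((n : ℝ) + 1) * (n + 2)) := by
      intro n
      induction n with
      | zero => norm_num
      | succ n ih =>
        rw [Finset.sum_range_succ]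
        have hn : (0 : ℝ) ≤ n := n.cast_nonneg
        have : 1 / (((n + 1 : ℕ) + 1 : ℕ) : ℝ) ^ 3 ≤ 1 / (2 * ((n : ℝ) + 1) * (n + 2)) -
            1 / (2 * (((n + 1 : ℕ) : ℝ) + 1) * ((n + 1 : ℕ) + 2)) := by
          push_cast
          rw [div_sub_div _ _ (by positivity) (by positivity), div_le_div_iff₀ (by positivity) (by positivity)]
          have : 0 ≤ (n : ℝ) ^ 2 := by positivity
          nlinarith [pow_nonneg hn 3, pow_nonneg hn 4, pow_nonneg hn 5]
        linarith
    have hn : (0 : ℝ) ≤ n := n.cast_nonneg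
    have : 0 ≤ 1 / (2 * ((n : ℝ) + 1) * (n + 2)) := by positivity
    linarith [h n]

theorem tsum_hermite_le : ∑' A : ℕ × (Σ d : ℕ, Fin (d + 1)),
    ENNReal.ofReal (1 / ((A.1 + 1 : ℕ) : ℝ) ^ 3) * ENNReal.ofReal (1 / ((A.2.1 + 1 : ℕ) : ℝ) ^ 3) ≤
      ENNReal.ofReal (5 * Real.pi ^ 2 / 24) := by
  rw [ENNReal.tsum_prod']
  simp only [ENNReal.tsum_sigma', ENNReal.tsum_mul_left, ENNReal.tsum_mul_right, tsum_fintype,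
    Finset.sum_const, Finset.card_univ, Fintype.card_fin]
  -- The `d + 1` residues `b` turn a cube into a square, so the double sum is `ζ(3) ζ(2)`.
  have e : ∀ d : ℕ, (d + 1) • ENNReal.ofReal (1 / ((d + 1 : ℕ) : ℝ) ^ 3) =
      ENNReal.ofReal (1 / ((d + 1 : ℕ) : ℝ) ^ 2) := by
    intro d
    rw [← ENNReal.ofReal_nsmul]
    congr 1
    rw [nsmul_eq_mul]
    field_simp
  simp_rw [e]
  refine (mul_le_mul' tsum_cube_le tsum_sq_le).trans ?_
  rw [← ENNReal.ofReal_mul (by norm_num)]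
  exact ENNReal.ofReal_le_ofReal (by linarith)

/-- Upper bound for the integral of the sum over linearly independent pairs of lattice vectors. -/
theorem lintegral_indep_le {F : (Fin 3 → ℝ) × (Fin 3 → ℝ) → ℝ≥0∞} (hF : Measurable F) :
    ∫⁻ g in fundDomain, ∑' x : {x : (Fin 3 → ℤ) × (Fin 3 → ℤ) // latPt x.1 g ⨯₃ latPt x.2 g ≠ 0},
      F (latPt x.1.1 g, latPt x.1.2 g) ∂(Measure.haar : Measure G) ≤
      cellConst * ENNReal.ofReal (5 * Real.pi ^ 2 / 24) * ∫⁻ p, F p := by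
  refine (lintegral_mono fun g => tsum_indep_le g F).trans ?_
  let H : ℕ × (Σ d : ℕ, Fin (d + 1)) → (Fin 3 → ℝ) × (Fin 3 → ℝ) → ℝ≥0∞ := fun A p =>
    F (((A.1 + 1 : ℕ) : ℝ) • p.1, ((A.2.2 : ℕ) : ℝ) • p.1 + ((A.2.1 + 1 : ℕ) : ℝ) • p.2)
  have hH : ∀ A, Measurable (H A) := fun A => hF.comp (by fun_prop)
  have hmr : ∀ A, Measurable fun g : G => H A (rows g 0, rows g 1) := fun A =>
    (hH A).comp (((measurable_pi_apply 0).comp measurable_rows).prodMk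
      ((measurable_pi_apply 1).comp measurable_rows))
  have h1 : ∀ A, ∫⁻ g in fundDomain, ∑' γ : Γ,
      cell.indicator (fun h => H A (rows h 0, rows h 1)) (γ • g) ∂(Measure.haar : Measure G) =
      cellConst * (ENNReal.ofReal (1 / ((A.1 + 1 : ℕ) : ℝ) ^ 3) *
        ENNReal.ofReal (1 / ((A.2.1 + 1 : ℕ) : ℝ) ^ 3)) * ∫⁻ p, F p := by
    intro A
    rw [lintegral_fundDomain_cell (hH A), lintegral_triangular hF (by positivity) (by positivity)]
    ring
  calc _ = ∑' A, ∫⁻ g in fundDomain, ∑' γ : Γ,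
      cell.indicator (fun h => H A (rows h 0, rows h 1)) (γ • g) ∂(Measure.haar : Measure G) :=
        lintegral_tsum fun A => (Measurable.tsum fun γ : Γ =>
          measurable_comp_smul ((hmr A).indicator measurableSet_cell) γ).aemeasurable
    _ ≤ _ := by
      simp_rw [h1]
      rw [ENNReal.tsum_mul_right, ENNReal.tsum_mul_left]
      gcongr
      exact tsum_hermite_le

/-! ### Finiteness of the covolume. -/

theorem vecMul_eq_mulVec_transpose (x : Fin 3 → ℝ) (g : G) :
    x ᵥ* g.1 = (g.1)ᵀ *ᵥ x := (mulVec_transpose g.1 x).symm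

theorem volume_preimage_vecMul (g : G) {K : Set (Fin 3 → ℝ)} (hK : MeasurableSet K) :
    volume {x : Fin 3 → ℝ | x ᵥ* g.1 ∈ K} = volume K := by
  have hd : ((g.1)ᵀ).det = 1 := by rw [det_transpose]; exact g.2
  have h := lintegral_comp_mulVec (A := (g.1)ᵀ) (by simp [hd])
    (f := K.indicator 1) (measurable_one.indicator hK)
  rw [hd, lintegral_indicator_one hK] at h
  simp only [inv_one, abs_one, ENNReal.ofReal_one, one_mul] at h
  rw [← h, ← lintegral_indicator_one]
  · refine lintegral_congr fun x => ?_
    simp only [vecMul_eq_mulVec_transpose]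
    rfl
  · exact (Continuous.measurable (by fun_prop)) hK

theorem card_le_tsum_latPt (g : G) (K : Set (Fin 3 → ℝ)) {n : ℕ} (hn : n ≠ 0) :
    ((Nat.card ↑({x : Fin 3 → ℝ | x ᵥ* g.1 ∈ K} ∩
      (n : ℝ)⁻¹ • (Submodule.span ℤ (Set.range (Pi.basisFun ℝ (Fin 3))) : Set (Fin 3 → ℝ))) : ℕ) : ℝ≥0∞) ≤
    ∑' p : Fin 3 → ℤ, ((n : ℝ) • K).indicator 1 (latPt p g) := by
  set S := {x : Fin 3 → ℝ | x ᵥ* g.1 ∈ K} ∩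
      (n : ℝ)⁻¹ • (Submodule.span ℤ (Set.range (Pi.basisFun ℝ (Fin 3))) : Set (Fin 3 → ℝ)) with hS
  have hn' : (n : ℝ) ≠ 0 := Nat.cast_ne_zero.2 hn
  have h1 : ∀ x : S, ∃ p : Fin 3 → ℤ, (n : ℝ) • x.1 = fun i => (p i : ℝ) := by
    rintro ⟨x, hx, y, hy, rfl⟩
    have hy' := (Module.Basis.mem_span_iff_repr_mem ℤ (Pi.basisFun ℝ (Fin 3)) y).1 hy
    choose p hp using hy'
    refine ⟨p, ?_⟩
    ext i
    have := hp i
    simp only [Pi.basisFun_repr] at this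
    simp [hn', ← this]
  choose p hp using h1
  have hinj : Function.Injective p := by
    intro x y hxy
    apply Subtype.ext
    have : (n : ℝ) • x.1 = (n : ℝ) • y.1 := by rw [hp, hp, hxy]
    exact smul_right_injective _ hn' this
  -- `Nat.card` is `0` on an infinite set, which is harmless for an upper bound on it.
  calc ((Nat.card S : ℕ) : ℝ≥0∞) ≤ ((ENat.card S : ℕ∞) : ℝ≥0∞) := by
        rw [Nat.card]
        exact_mod_cast ENat.natCast_toNat_le_self _
    _ = ∑' x : S, 1 := by rw [ENNReal.tsum_set_one]; rfl
    _ = ∑' x : S, ((n : ℝ) • K).indicator (1 : (Fin 3 → ℝ) → ℝ≥0∞) (latPt (p x) g) := by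
        refine tsum_congr fun x => ?_
        rw [Set.indicator_of_mem]
        · rfl
        · rw [latPt, ← hp, smul_vecMul]
          exact Set.smul_mem_smul_set x.2.1
    _ ≤ _ := ENNReal.tsum_comp_le_tsum_of_injective hinj _

/-- The preimage of a unit box under `g` is compact and convex of volume one, so its frontier is
null and the density of points of `n⁻¹ℤ³` in it tends to its volume. -/
theorem tendsto_card_box (g : G) (a : Fin 3 → ℝ) :
    Filter.Tendsto (fun n : ℕ => ENNReal.ofReal ((Nat.card
      ↑({x : Fin 3 → ℝ | x ᵥ* g.1 ∈ Set.Icc a (a + 1)} ∩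
      (n : ℝ)⁻¹ • (Submodule.span ℤ (Set.range (Pi.basisFun ℝ (Fin 3))) : Set (Fin 3 → ℝ))) : ℝ) /
        (n : ℝ) ^ 3)) Filter.atTop (nhds 1) := by
  have hv : volume {x : Fin 3 → ℝ | x ᵥ* g.1 ∈ Set.Icc a (a + 1)} = 1 := by
    rw [volume_preimage_vecMul g measurableSet_Icc, Real.volume_Icc_pi]
    simp
  have hconv : Convex ℝ {x : Fin 3 → ℝ | x ᵥ* g.1 ∈ Set.Icc a (a + 1)} :=
    (convex_Icc a (a + 1)).linear_preimage (Matrix.vecMulLinear g.1)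
  have hcomp : IsCompact {x : Fin 3 → ℝ | x ᵥ* g.1 ∈ Set.Icc a (a + 1)} := by
    have : {x : Fin 3 → ℝ | x ᵥ* g.1 ∈ Set.Icc a (a + 1)} =
        (fun y => y ᵥ* (g⁻¹).1) '' Set.Icc a (a + 1) := by
      have h1 : g.1 * (g⁻¹).1 = 1 := congrArg Subtype.val (mul_inv_cancel g)
      have h2 : (g⁻¹).1 * g.1 = 1 := congrArg Subtype.val (inv_mul_cancel g)
      ext x
      constructor
      · intro hx
        exact ⟨_, hx, by simp only [vecMul_vecMul]; rw [h1, vecMul_one]⟩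
      · rintro ⟨y, hy, rfl⟩
        simp only [Set.mem_ofPred_eq, vecMul_vecMul]
        rwa [h2, vecMul_one]
    rw [this]
    exact isCompact_Icc.image (by fun_prop)
  have h := tendsto_card_div_pow_atTop_volume _ hcomp.isBounded hcomp.measurableSet
    (hconv.addHaar_frontier volume)
  rw [measureReal_def, hv] at h
  simpa [Function.comp_def] using (ENNReal.continuous_ofReal.tendsto _).comp h

theorem continuous_latPt (p : Fin 3 → ℤ) : Continuous (latPt p) := by
  have h : latPt p = fun g => (p 0 : ℝ) • rows g 0 + (p 1 : ℝ) • rows g 1 + (p 2 : ℝ) • rows g 2 :=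
    funext fun g => latPt_eq p g
  have hr := isClosedEmbedding_rows.continuous
  rw [h]
  have : ∀ i, Continuous fun g => rows g i := fun i => (continuous_apply i).comp hr
  fun_prop

/-- Before scaling, the third coordinate of the cross product is at least `3 * 3 - 1 * 1`. -/
theorem cross_ne_zero_of_box {n : ℝ} (hn : n ≠ 0) {v u : Fin 3 → ℝ}
    (hv : v ∈ n • Set.Icc (![3, 0, 0] : Fin 3 → ℝ) (![3, 0, 0] + 1))
    (hu : u ∈ n • Set.Icc (![0, 3, 0] : Fin 3 → ℝ) (![0, 3, 0] + 1)) : v ⨯₃ u ≠ 0 := by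
  obtain ⟨x, ⟨hx0, hx1⟩, rfl⟩ := hv
  obtain ⟨y, ⟨hy0, hy1⟩, rfl⟩ := hu
  have a := hx0 0
  have b := hx1 1
  have b' := hx0 1
  have c := hy0 1
  have d := hy1 0
  have d' := hy0 0
  simp at a b c d b' d'
  intro h
  rw [cross_smul_smul, smul_eq_zero] at h
  rcases h with h | h
  · exact hn (pow_eq_zero_iff (two_ne_zero) |>.1 h)
  · have := congrFun h 2
    simp [cross_apply] at this
    nlinarith [mul_nonneg (sub_nonneg.2 a) (sub_nonneg.2 c), mul_nonneg b' d',
      mul_nonneg (sub_nonneg.2 b) (sub_nonneg.2 d)]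

/-- The covolume of `SL₃(ℤ)` is finite, with an explicit bound. -/
theorem haar_fundDomain_le : (Measure.haar : Measure G) fundDomain ≤
    cellConst * ENNReal.ofReal (5 * Real.pi ^ 2 / 24) := by
  let K1 := Set.Icc (![3, 0, 0] : Fin 3 → ℝ) (![3, 0, 0] + 1)
  let K2 := Set.Icc (![0, 3, 0] : Fin 3 → ℝ) (![0, 3, 0] + 1)
  let N : Set (Fin 3 → ℝ) → ℕ → G → ℝ≥0∞ := fun K n g =>
    ∑' p : Fin 3 → ℤ, (((n + 1 : ℕ) : ℝ) • K).indicator 1 (latPt p g)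
  let c : ℕ → ℝ≥0∞ := fun n => ENNReal.ofReal (1 / ((n + 1 : ℕ) : ℝ) ^ 3)
  have hKm : ∀ (n : ℕ) (a b : Fin 3 → ℝ), MeasurableSet (((n + 1 : ℕ) : ℝ) • Set.Icc a b) := by
    intro n a b
    exact (isCompact_Icc.smul _).measurableSet
  have hNm : ∀ n a b, Measurable (N (Set.Icc a b) n) := fun n a b =>
    Measurable.tsum fun p =>
      (measurable_one.indicator (hKm n a b)).comp (continuous_latPt p).measurable
  have hlim : ∀ g, 1 ≤ Filter.liminf (fun n => c n * N K1 n g * (c n * N K2 n g)) Filter.atTop := by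
    intro g
    have hb : ∀ a : Fin 3 → ℝ, ∀ n : ℕ, ENNReal.ofReal ((Nat.card
      ↑({x : Fin 3 → ℝ | x ᵥ* g.1 ∈ Set.Icc a (a + 1)} ∩
      ((n + 1 : ℕ) : ℝ)⁻¹ • (Submodule.span ℤ (Set.range (Pi.basisFun ℝ (Fin 3))) : Set (Fin 3 → ℝ))) : ℝ) /
        ((n + 1 : ℕ) : ℝ) ^ 3) ≤ c n * N (Set.Icc a (a + 1)) n g := by
      intro a n
      rw [div_eq_mul_one_div, mul_comm, ENNReal.ofReal_mul (by positivity), ENNReal.ofReal_natCast]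
      gcongr
      exact card_le_tsum_latPt g _ n.succ_ne_zero
    have ht := ENNReal.Tendsto.mul
      ((Filter.tendsto_add_atTop_iff_nat 1).2 (tendsto_card_box g ![3, 0, 0])) (Or.inl one_ne_zero)
      ((Filter.tendsto_add_atTop_iff_nat 1).2 (tendsto_card_box g ![0, 3, 0])) (Or.inl one_ne_zero)
    rw [mul_one] at ht
    rw [← ht.liminf_eq]
    exact Filter.liminf_le_liminf (Filter.Eventually.of_forall fun n =>
      mul_le_mul' (hb _ n) (hb _ n))
  have hint : ∀ n, ∫⁻ g in fundDomain, c n * N K1 n g * (c n * N K2 n g) ∂(Measure.haar : Measure G) ≤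
      cellConst * ENNReal.ofReal (5 * Real.pi ^ 2 / 24) := by
    intro n
    let F : (Fin 3 → ℝ) × (Fin 3 → ℝ) → ℝ≥0∞ := fun p =>
      (((n + 1 : ℕ) : ℝ) • K1).indicator 1 p.1 * (((n + 1 : ℕ) : ℝ) • K2).indicator 1 p.2
    have hF1 : Measurable ((((n + 1 : ℕ) : ℝ) • K1).indicator (1 : (Fin 3 → ℝ) → ℝ≥0∞)) :=
      measurable_one.indicator (hKm n _ _)
    have hF2 : Measurable ((((n + 1 : ℕ) : ℝ) • K2).indicator (1 : (Fin 3 → ℝ) → ℝ≥0∞)) :=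
      measurable_one.indicator (hKm n _ _)
    have hF : Measurable F := (hF1.comp measurable_fst).mul (hF2.comp measurable_snd)
    -- Every pair with one point in each box is independent, so restricting the sum to independent
    -- pairs loses nothing.
    have hle : ∀ g, N K1 n g * N K2 n g ≤
        ∑' x : {x : (Fin 3 → ℤ) × (Fin 3 → ℤ) // latPt x.1 g ⨯₃ latPt x.2 g ≠ 0},
          F (latPt x.1.1 g, latPt x.1.2 g) := by
      intro g
      have e : N K1 n g * N K2 n g = ∑' x : (Fin 3 → ℤ) × (Fin 3 → ℤ),
          F (latPt x.1 g, latPt x.2 g) := by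
        rw [ENNReal.tsum_prod']
        simp only [F, N, ENNReal.tsum_mul_left, ENNReal.tsum_mul_right]
      rw [e]
      refine (tsum_subtype_eq_of_support_subset (s := {x : (Fin 3 → ℤ) × (Fin 3 → ℤ) |
        latPt x.1 g ⨯₃ latPt x.2 g ≠ 0}) ?_).ge
      intro x hx
      have hx' := mul_ne_zero_iff.1 hx
      exact cross_ne_zero_of_box (by positivity) (Set.mem_of_indicator_ne_zero hx'.1)
        (Set.mem_of_indicator_ne_zero hx'.2)
    have hvol : ∀ a : Fin 3 → ℝ, volume (((n + 1 : ℕ) : ℝ) • Set.Icc a (a + 1)) =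
        ENNReal.ofReal (((n + 1 : ℕ) : ℝ) ^ 3) := by
      intro a
      rw [Measure.addHaar_smul, Real.volume_Icc_pi, abs_of_pos (by positivity)]
      simp
    have hFint : ∫⁻ p, F p = ENNReal.ofReal (((n + 1 : ℕ) : ℝ) ^ 3) *
        ENNReal.ofReal (((n + 1 : ℕ) : ℝ) ^ 3) := by
      rw [Measure.volume_eq_prod, lintegral_prod_mul hF1.aemeasurable hF2.aemeasurable,
        lintegral_indicator_one (hKm n _ _), lintegral_indicator_one (hKm n _ _), hvol, hvol]
    have hc : c n * ENNReal.ofReal (((n + 1 : ℕ) : ℝ) ^ 3) = 1 := by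
      rw [← ENNReal.ofReal_mul (by positivity), one_div, inv_mul_cancel₀ (by positivity),
        ENNReal.ofReal_one]
    calc _ = ∫⁻ g in fundDomain, c n * c n * (N K1 n g * N K2 n g) ∂(Measure.haar : Measure G) :=
          lintegral_congr fun g => by ring
      _ = c n * c n * ∫⁻ g in fundDomain, N K1 n g * N K2 n g ∂(Measure.haar : Measure G) :=
          lintegral_const_mul _ ((hNm n _ _).mul (hNm n _ _))
      _ ≤ c n * c n * (cellConst * ENNReal.ofReal (5 * Real.pi ^ 2 / 24) * ∫⁻ p, F p) := by
          gcongr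
          exact (lintegral_mono hle).trans (lintegral_indep_le hF)
      _ = (c n * ENNReal.ofReal (((n + 1 : ℕ) : ℝ) ^ 3)) *
          (c n * ENNReal.ofReal (((n + 1 : ℕ) : ℝ) ^ 3)) *
          (cellConst * ENNReal.ofReal (5 * Real.pi ^ 2 / 24)) := by rw [hFint]; ring
      _ = _ := by rw [hc, one_mul, one_mul]
  calc (Measure.haar : Measure G) fundDomain
      = ∫⁻ g in fundDomain, 1 ∂(Measure.haar : Measure G) := by simp
    _ ≤ ∫⁻ g in fundDomain, Filter.liminf (fun n => c n * N K1 n g * (c n * N K2 n g)) Filter.atTop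
          ∂(Measure.haar : Measure G) := lintegral_mono hlim
    _ ≤ Filter.liminf (fun n => ∫⁻ g in fundDomain, c n * N K1 n g * (c n * N K2 n g)
          ∂(Measure.haar : Measure G)) Filter.atTop :=
        lintegral_liminf_le fun n => ((hNm n _ _).const_mul _).mul ((hNm n _ _).const_mul _)
    _ ≤ _ := Filter.liminf_le_of_le (by isBoundedDefault) fun b hb => by
        obtain ⟨n, hn⟩ := hb.exists
        exact hn.trans (hint n)

theorem haar_fundDomain_ne_zero : (Measure.haar : Measure G) fundDomain ≠ 0 :=
  isFundamentalDomain_fundDomain.measure_ne_zero (NeZero.ne _)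

/-! ### The area of the half disc. -/

/-- Pairs `(v, u)` such that `u` is reduced along `v` and projects along `v` to a half disc. -/
def halfDiscPairs : Set ((Fin 3 → ℝ) × (Fin 3 → ℝ)) :=
  {p | p.1 0 ≠ 0 ∧ p.2 0 / p.1 0 ∈ Set.Ico (0 : ℝ) 1 ∧
    0 < p.2 1 - p.2 0 / p.1 0 * p.1 1 ∧
    |p.1 0| * ((p.2 1 - p.2 0 / p.1 0 * p.1 1) ^ 2 + (p.2 2 - p.2 0 / p.1 0 * p.1 2) ^ 2) < 1}

theorem measurableSet_halfDiscPairs : MeasurableSet halfDiscPairs := by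
  have h0 : Measurable fun p : (Fin 3 → ℝ) × (Fin 3 → ℝ) => p.1 0 := by fun_prop
  have h1 : Measurable fun p : (Fin 3 → ℝ) × (Fin 3 → ℝ) => p.2 0 / p.1 0 := by fun_prop
  have h2 : Measurable fun p : (Fin 3 → ℝ) × (Fin 3 → ℝ) => p.2 1 - p.2 0 / p.1 0 * p.1 1 := by
    fun_prop
  have h3 : Measurable fun p : (Fin 3 → ℝ) × (Fin 3 → ℝ) => p.2 2 - p.2 0 / p.1 0 * p.1 2 := by
    fun_prop
  have h4 : Measurable fun p : (Fin 3 → ℝ) × (Fin 3 → ℝ) => |p.1 0| := h0.norm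
  exact ((measurableSet_singleton (0 : ℝ)).compl.preimage h0).inter ((measurableSet_Ico.preimage h1).inter
    ((measurableSet_lt measurable_const h2).inter
      (measurableSet_lt (h4.mul ((h2.pow_const 2).add (h3.pow_const 2))) measurable_const)))

theorem integral_quarter_disc : ∫ x in (0 : ℝ)..1, √(1 - x ^ 2) = Real.pi / 4 := by
  have hi : ∀ a b : ℝ, IntervalIntegrable (fun x : ℝ => √(1 - x ^ 2)) volume a b := fun a b =>
    Continuous.intervalIntegrable (by fun_prop) a b
  have h1 := integral_sqrt_one_sub_sq
  rw [← intervalIntegral.integral_add_adjacent_intervals (hi (-1) 0) (hi 0 1)] at h1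
  have h2 := intervalIntegral.integral_comp_neg (a := (0 : ℝ)) (b := 1) fun x : ℝ => √(1 - x ^ 2)
  simp only [neg_sq, neg_zero] at h2
  linarith

theorem lintegral_half_disc : ∫⁻ b : ℝ, ∫⁻ c : ℝ,
    {p : ℝ × ℝ | 0 < p.1 ∧ p.1 ^ 2 + p.2 ^ 2 < 1}.indicator (1 : ℝ × ℝ → ℝ≥0∞) (b, c) =
      ENNReal.ofReal (Real.pi / 2) := by
  have h1 : ∀ b : ℝ, ∫⁻ c : ℝ,
      {p : ℝ × ℝ | 0 < p.1 ∧ p.1 ^ 2 + p.2 ^ 2 < 1}.indicator (1 : ℝ × ℝ → ℝ≥0∞) (b, c) =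
      (Set.Ioc (0 : ℝ) 1).indicator (fun b => ENNReal.ofReal (2 * √(1 - b ^ 2))) b := by
    intro b
    have e : ∀ c : ℝ,
        {p : ℝ × ℝ | 0 < p.1 ∧ p.1 ^ 2 + p.2 ^ 2 < 1}.indicator (1 : ℝ × ℝ → ℝ≥0∞) (b, c) =
        (Set.Ioi (0 : ℝ)).indicator 1 b *
          (Set.Ioo (-√(1 - b ^ 2)) (√(1 - b ^ 2))).indicator 1 c := by
      intro c
      have hc : b ^ 2 + c ^ 2 < 1 ↔ c ∈ Set.Ioo (-√(1 - b ^ 2)) (√(1 - b ^ 2)) := by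
        rw [Set.mem_Ioo, ← Real.sq_lt]
        constructor <;> intro h <;> linarith
      by_cases hb : 0 < b
      · by_cases h : b ^ 2 + c ^ 2 < 1
        · rw [Set.indicator_of_mem (show (b, c) ∈ {p : ℝ × ℝ | 0 < p.1 ∧ p.1 ^ 2 + p.2 ^ 2 < 1} from ⟨hb, h⟩),
            Set.indicator_of_mem (show b ∈ Set.Ioi (0 : ℝ) from hb), Set.indicator_of_mem (hc.1 h)]
          simp
        · rw [Set.indicator_of_notMem (fun h' => h h'.2),
            Set.indicator_of_notMem (fun h' => h (hc.2 h')), mul_zero]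
      · rw [Set.indicator_of_notMem (fun h' => hb h'.1),
          Set.indicator_of_notMem (show b ∉ Set.Ioi (0 : ℝ) from hb), zero_mul]
    simp_rw [e]
    rw [lintegral_const_mul _ (measurable_one.indicator measurableSet_Ioo),
      lintegral_indicator_one measurableSet_Ioo, Real.volume_Ioo]
    rw [show √(1 - b ^ 2) - -√(1 - b ^ 2) = 2 * √(1 - b ^ 2) by ring]
    by_cases hb : 0 < b
    · rw [Set.indicator_of_mem (show b ∈ Set.Ioi (0 : ℝ) from hb)]
      by_cases hb1 : b ≤ 1
      · rw [Set.indicator_of_mem (show b ∈ Set.Ioc (0 : ℝ) 1 from ⟨hb, hb1⟩)]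
        simp
      -- For `b > 1` the radicand is negative and `√` returns `0`, so the range of `c` is empty.
      · rw [Set.indicator_of_notMem (fun h' => hb1 h'.2),
          Real.sqrt_eq_zero_of_nonpos (by nlinarith)]
        simp
    · rw [Set.indicator_of_notMem (show b ∉ Set.Ioi (0 : ℝ) from hb),
        Set.indicator_of_notMem (fun h' => hb h'.1), zero_mul]
  simp_rw [h1]
  have hint : IntegrableOn (fun b : ℝ => 2 * √(1 - b ^ 2)) (Set.Ioc 0 1) :=
    (Continuous.integrableOn_Icc (by fun_prop)).mono_set Set.Ioc_subset_Icc_self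
  rw [lintegral_indicator measurableSet_Ioc, ← ofReal_integral_eq_lintegral_ofReal hint
    (Filter.Eventually.of_forall fun b => by positivity), ← intervalIntegral.integral_of_le zero_le_one,
    intervalIntegral.integral_const_mul, integral_quarter_disc]
  congr 1
  ring

/-- The half disc has area `π / (2|v 0|)` and the coordinate `u 0` runs over an interval of length
`|v 0|`. The radius in `halfDiscPairs` makes the product independent of `v`. -/
theorem lintegral_halfDisc_section {v : Fin 3 → ℝ} (hv : v 0 ≠ 0) :
    ∫⁻ u, halfDiscPairs.indicator (1 : (Fin 3 → ℝ) × (Fin 3 → ℝ) → ℝ≥0∞) (v, u) = ENNReal.ofReal (Real.pi / 2) := by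
  let s := √|v 0|
  have hs : s ^ 2 = |v 0| := Real.sq_sqrt (abs_nonneg _)
  have hs0 : 0 < s := Real.sqrt_pos.2 (abs_pos.2 hv)
  -- `A` records `u 0 / v 0` and `√|v 0|` times the projection of `u` along `v`; it maps the section
  -- onto an interval times the unit half disc, with determinant `±1`.
  let A : Matrix (Fin 3) (Fin 3) ℝ :=
    !![1 / v 0, 0, 0; -s * v 1 / v 0, s, 0; -s * v 2 / v 0, 0, s]
  have hdet : A.det = |v 0| / v 0 := by
    simp [A, det_fin_three]
    rw [← hs]
    ring
  have habs : |A.det| = 1 := by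
    rw [hdet, abs_div, abs_abs, div_self (abs_ne_zero.2 hv)]
  let Q : Set (Fin 3 → ℝ) := {x | x 0 ∈ Set.Ico (0 : ℝ) 1 ∧ 0 < x 1 ∧ x 1 ^ 2 + x 2 ^ 2 < 1}
  have hQ : MeasurableSet Q :=
    (measurableSet_Ico.preimage (measurable_pi_apply 0)).inter
      ((measurableSet_lt measurable_const (measurable_pi_apply 1)).inter
      (measurableSet_lt (((measurable_pi_apply 1).pow_const 2).add
        ((measurable_pi_apply 2).pow_const 2)) measurable_const))
  have hmem : ∀ u, (v, u) ∈ halfDiscPairs ↔ A *ᵥ u ∈ Q := by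
    intro u
    have e0 : (A *ᵥ u) 0 = u 0 / v 0 := by
      simp [A, mulVec, dotProduct, Fin.sum_univ_three]; field_simp
    have e1 : (A *ᵥ u) 1 = s * (u 1 - u 0 / v 0 * v 1) := by
      simp [A, mulVec, dotProduct, Fin.sum_univ_three]; field_simp; ring
    have e2 : (A *ᵥ u) 2 = s * (u 2 - u 0 / v 0 * v 2) := by
      simp [A, mulVec, dotProduct, Fin.sum_univ_three]; field_simp; ring
    simp only [halfDiscPairs, Q, Set.mem_ofPred_eq, e0, e1, e2, mul_pow, hs, ← mul_add,
      mul_pos_iff_of_pos_left hs0]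
    tauto
  have h := lintegral_comp_mulVec (A := A) (fun h => by simp [h] at habs)
    (measurable_one.indicator hQ : Measurable (Q.indicator (1 : (Fin 3 → ℝ) → ℝ≥0∞)))
  rw [abs_inv, habs] at h
  calc _ = ∫⁻ u, Q.indicator (1 : (Fin 3 → ℝ) → ℝ≥0∞) (A *ᵥ u) := by
        refine lintegral_congr fun u => ?_
        by_cases hu : (v, u) ∈ halfDiscPairs
        · rw [Set.indicator_of_mem hu, Set.indicator_of_mem ((hmem u).1 hu)]; rfl
        · rw [Set.indicator_of_notMem hu, Set.indicator_of_notMem (fun h => hu ((hmem u).2 h))]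
    _ = ∫⁻ x, Q.indicator (1 : (Fin 3 → ℝ) → ℝ≥0∞) x := by rw [h]; simp
    _ = ∫⁻ a, ∫⁻ b, ∫⁻ c, (Set.Ico (0 : ℝ) 1).indicator (1 : ℝ → ℝ≥0∞) a *
        {p : ℝ × ℝ | 0 < p.1 ∧ p.1 ^ 2 + p.2 ^ 2 < 1}.indicator (1 : ℝ × ℝ → ℝ≥0∞) (b, c) := by
        rw [lintegral_fin_three (measurable_one.indicator hQ)]
        refine lintegral_congr fun a => lintegral_congr fun b => lintegral_congr fun c => ?_
        by_cases ha : a ∈ Set.Ico (0 : ℝ) 1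
        · rw [Set.indicator_of_mem ha]
          by_cases hb : (b, c) ∈ {p : ℝ × ℝ | 0 < p.1 ∧ p.1 ^ 2 + p.2 ^ 2 < 1}
          · rw [Set.indicator_of_mem hb, Set.indicator_of_mem]
            · simp
            · exact ⟨ha, hb⟩
          · rw [Set.indicator_of_notMem hb, Set.indicator_of_notMem, mul_zero]
            exact fun h => hb h.2
        · rw [Set.indicator_of_notMem ha, Set.indicator_of_notMem, zero_mul]
          exact fun h => ha h.1
    _ = ∫⁻ a, (Set.Ico (0 : ℝ) 1).indicator (1 : ℝ → ℝ≥0∞) a * ENNReal.ofReal (Real.pi / 2) := by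
        refine lintegral_congr fun a => ?_
        have ht : (Set.Ico (0 : ℝ) 1).indicator (1 : ℝ → ℝ≥0∞) a ≠ ∞ := by
          by_cases ha : a ∈ Set.Ico (0 : ℝ) 1 <;> simp [Set.indicator, ha]
        simp_rw [lintegral_const_mul' _ _ ht]
        rw [lintegral_half_disc]
    _ = _ := by
        rw [lintegral_mul_const _ (measurable_one.indicator measurableSet_Ico),
          lintegral_indicator_one measurableSet_Ico]
        simp

theorem ae_first_ne_zero : ∀ᵐ v : Fin 3 → ℝ, v 0 ≠ 0 := by
  have hs : LinearMap.ker (LinearMap.proj (R := ℝ) (φ := fun _ : Fin 3 => ℝ) 0) ≠ ⊤ := by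
    intro h
    rw [LinearMap.ker_eq_top] at h
    have := LinearMap.congr_fun h 1
    simp at this
  have := Measure.addHaar_submodule volume _ hs
  rw [ae_iff]
  convert! this using 2
  ext u; simp

theorem lintegral_halfDiscPairs {Ω : Set (Fin 3 → ℝ)} (hΩ : MeasurableSet Ω) :
    ∫⁻ p : (Fin 3 → ℝ) × (Fin 3 → ℝ), Ω.indicator (1 : (Fin 3 → ℝ) → ℝ≥0∞) p.1 *
      halfDiscPairs.indicator (1 : (Fin 3 → ℝ) × (Fin 3 → ℝ) → ℝ≥0∞) p = ENNReal.ofReal (Real.pi / 2) * volume Ω := by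
  have hΩm : Measurable (Ω.indicator (1 : (Fin 3 → ℝ) → ℝ≥0∞)) := measurable_one.indicator hΩ
  have hSm : Measurable (halfDiscPairs.indicator (1 : (Fin 3 → ℝ) × (Fin 3 → ℝ) → ℝ≥0∞)) :=
    measurable_one.indicator measurableSet_halfDiscPairs
  have hm : Measurable fun p : (Fin 3 → ℝ) × (Fin 3 → ℝ) =>
      Ω.indicator (1 : (Fin 3 → ℝ) → ℝ≥0∞) p.1 *
        halfDiscPairs.indicator (1 : (Fin 3 → ℝ) × (Fin 3 → ℝ) → ℝ≥0∞) p :=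
    (hΩm.comp measurable_fst).mul hSm
  rw [Measure.volume_eq_prod, lintegral_prod _ hm.aemeasurable,
    mul_comm, ← lintegral_indicator_one hΩ, ← lintegral_mul_const _ hΩm]
  refine lintegral_congr_ae ?_
  filter_upwards [ae_first_ne_zero] with v hv
  rw [← lintegral_halfDisc_section hv]
  exact lintegral_const_mul _ (hSm.comp (measurable_prodMk_left (x := v)))

/-! ### At most one admissible frame for each first row. -/

/-- With rows `v, u, w`, the cross product is `n 1 • (v ⨯₃ u) + n 2 • (v ⨯₃ w)`. Pairing it with `w`
and with `u` isolates the coefficients, since the determinant is one. -/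
theorem coords_of_cross_eq_zero (g : G) {n : Fin 3 → ℤ} (h : rows g 0 ⨯₃ latPt n g = 0) :
    n 1 = 0 ∧ n 2 = 0 := by
  have hd := cross_rows g
  have h0 := congrFun h 0
  have h1 := congrFun h 1
  have h2 := congrFun h 2
  rw [latPt_eq] at h0 h1 h2
  simp [cross_apply, dotProduct, Fin.sum_univ_three] at hd h0 h1 h2
  constructor
  · have : (n 1 : ℝ) = 0 := by
      linear_combination (-(n 1 : ℝ)) * hd + rows g 2 0 * h0 + rows g 2 1 * h1 + rows g 2 2 * h2
    exact_mod_cast this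
  · have : (n 2 : ℝ) = 0 := by
      linear_combination (-(n 2 : ℝ)) * hd - rows g 1 0 * h0 - rows g 1 1 * h1 - rows g 1 2 * h2
    exact_mod_cast this

theorem first_row_eq {δ : Matrix.SpecialLinearGroup (Fin 3) ℤ} {g : G}
    (h : rows g 0 ⨯₃ rows (ofInt δ • g) 0 = 0) :
    δ.1 0 1 = 0 ∧ δ.1 0 2 = 0 ∧ (δ.1 0 0 = 1 ∨ δ.1 0 0 = -1) := by
  rw [rows_ofInt_smul] at h
  obtain ⟨h1, h2⟩ := coords_of_cross_eq_zero g h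
  refine ⟨h1, h2, ?_⟩
  have hd := δ.2
  rw [det_fin_three, h1, h2] at hd
  exact Int.isUnit_iff.1 (IsUnit.of_mul_eq_one (δ.1 1 1 * δ.1 2 2 - δ.1 1 2 * δ.1 2 1)
    (by linear_combination hd))

theorem eq_zero_of_add_mem_Ico {k : ℤ} {x y : ℝ} (hx : x ∈ Set.Ico (0 : ℝ) 1)
    (hy : y ∈ Set.Ico (0 : ℝ) 1) (h : y = k + x) : k = 0 := by
  have h1 : (-1 : ℝ) < k := by linarith [hx.2, hy.1]
  have h2 : (k : ℝ) < 1 := by linarith [hx.1, hy.2]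
  have h3 : -1 < k := by exact_mod_cast h1
  have h4 : k < 1 := by exact_mod_cast h2
  omega

/-- The entries of `δ` are forced in turn: the common first row fixes row `0`, the disc gives `δ 1 2
= 0`, the choice of half disc gives `δ 1 1 = 1`, reduction of `u` along `v` gives `δ 1 0 = 0`, and
`cell` fixes the last row. -/
theorem eq_one_of_mem_halfDiscPairs {δ : Matrix.SpecialLinearGroup (Fin 3) ℤ} {g : G}
    (hg : g ∈ cell) (hg' : ofInt δ • g ∈ cell) (hS : (rows g 0, rows g 1) ∈ halfDiscPairs)
    (hS' : (rows (ofInt δ • g) 0, rows (ofInt δ • g) 1) ∈ halfDiscPairs)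
    (h : rows (ofInt δ • g) 0 = rows g 0) : δ = 1 := by
  obtain ⟨d01, d02, d00⟩ := first_row_eq (δ := δ) (g := g) (by rw [h, cross_self])
  obtain ⟨hv, ha, hy, hyz⟩ := hS
  obtain ⟨-, ha', hy', hyz'⟩ := hS'
  replace d00 : δ.1 0 0 = 1 := by
    rcases d00 with d00 | d00
    · exact d00
    · exfalso
      have := congrFun h 0
      rw [rows_ofInt_smul, latPt_eq, d00, d01, d02] at this
      simp at this
      exact hv (by simp only; linarith)
  have hd := δ.2
  rw [det_fin_three, d00, d01, d02] at hd
  simp only at hv ha hy hyz ha' hy' hyz'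
  rw [h] at ha' hy' hyz'
  have hu : rows (ofInt δ • g) 1 = latPt (δ.1 1) g := rows_ofInt_smul δ g 1
  have hw : rows (ofInt δ • g) 2 = latPt (δ.1 2) g := rows_ofInt_smul δ g 2
  have hcell := hg'
  simp only [cell, Set.mem_ofPred_eq] at hcell hg
  rw [h] at hcell
  have hdet := cross_rows g
  set v := rows g 0 with hvdef
  set u := rows g 1 with hudef
  set w := rows g 2 with hwdef
  set u' := rows (ofInt δ • g) 1 with hu'def
  have d12 : δ.1 1 2 = 0 := by
    -- The coefficient of `w` in `u'` is `det(v, u, u')`, that is, `v 0` times the determinant of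
    -- the two projections. It is an integer, and both projections lying in the disc force its
    -- square below one.
    have e : (δ.1 1 2 : ℝ) = v 0 * ((u 1 - u 0 / v 0 * v 1) * (u' 2 - u' 0 / v 0 * v 2) -
        (u 2 - u 0 / v 0 * v 2) * (u' 1 - u' 0 / v 0 * v 1)) := by
      have e1 : (δ.1 1 2 : ℝ) = (v ⨯₃ u) ⬝ᵥ u' := by
        rw [hu, latPt_eq, dotProduct_add, dotProduct_add, dotProduct_smul, dotProduct_smul,
          dotProduct_smul, hdet, dotProduct_comm _ v, dot_self_cross, dotProduct_comm _ u,
          dot_cross_self]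
        simp
      rw [e1]
      simp [cross_apply, dotProduct, Fin.sum_univ_three]
      field_simp
      ring
    have hlt : (δ.1 1 2 : ℝ) ^ 2 < 1 := by
      rw [e, mul_pow, ← sq_abs (v 0)]
      generalize u 1 - u 0 / v 0 * v 1 = y at *
      generalize u 2 - u 0 / v 0 * v 2 = z at *
      generalize u' 1 - u' 0 / v 0 * v 1 = y' at *
      generalize u' 2 - u' 0 / v 0 * v 2 = z' at *
      have h1 : |v 0| ^ 2 * (y * z' - z * y') ^ 2 ≤
          (|v 0| * (y ^ 2 + z ^ 2)) * (|v 0| * (y' ^ 2 + z' ^ 2)) := by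
        have : (y * z' - z * y') ^ 2 ≤ (y ^ 2 + z ^ 2) * (y' ^ 2 + z' ^ 2) := by
          nlinarith [sq_nonneg (y * y' + z * z')]
        nlinarith [mul_le_mul_of_nonneg_left this (sq_nonneg |v 0|)]
      refine h1.trans_lt ?_
      exact mul_lt_one_of_nonneg_of_lt_one_left (by positivity) hyz hyz'.le
    have h2 : (δ.1 1 2) ^ 2 < 1 := by exact_mod_cast hlt
    by_contra hne
    have := sq_pos_of_ne_zero hne
    omega
  have hlt : δ.1 1 1 * δ.1 2 2 = 1 := by rw [d12] at hd; linear_combination hd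
  have hu2 : ∀ j, u' j = (δ.1 1 0 : ℝ) * v j + (δ.1 1 1 : ℝ) * u j := by
    intro j
    rw [hu, latPt_eq, d12]
    simp [hvdef, hudef]
  -- The value `-1` would reflect the projection into the opposite half disc.
  have d11 : δ.1 1 1 = 1 := by
    rcases Int.isUnit_iff.1 (IsUnit.of_mul_eq_one _ hlt) with h1 | h1
    · exact h1
    · exfalso
      rw [hu2, hu2, h1] at hy'
      have : (δ.1 1 0 : ℝ) * v 1 + ((-1 : ℤ) : ℝ) * u 1 -
          ((δ.1 1 0 : ℝ) * v 0 + ((-1 : ℤ) : ℝ) * u 0) / v 0 * v 1 =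
          -(u 1 - u 0 / v 0 * v 1) := by
        push_cast
        field_simp
        ring
      rw [this] at hy'
      linarith
  have d22 : δ.1 2 2 = 1 := by rw [d11, one_mul] at hlt; exact hlt
  have d10 : δ.1 1 0 = 0 := by
    refine eq_zero_of_add_mem_Ico ha ha' ?_
    rw [hu2, d11]
    push_cast
    field_simp
  have hu3 : u' = u := by
    ext j
    rw [hu2, d10, d11]
    simp
  have hw3 : rows (ofInt δ • g) 2 = (δ.1 2 0 : ℝ) • v + (δ.1 2 1 : ℝ) • u + w := by
    rw [hw, latPt_eq, d22]
    simp [hvdef, hudef, hwdef]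
  have hne : v ⨯₃ u ≠ 0 := cross_rows_ne_zero g
  rw [hu3, hw3, offA_add hne, offB_add hne] at hcell
  have d20 := eq_zero_of_add_mem_Ico hg.1 hcell.1 rfl
  have d21 := eq_zero_of_add_mem_Ico hg.2 hcell.2 rfl
  apply Subtype.ext
  change δ.1 = 1
  ext i j
  fin_cases i <;> fin_cases j <;> simp [d00, d01, d02, d10, d11, d12, d20, d21, d22]

/-- Elements of the cell whose first row lies in `Ω` and whose second row is short. -/
def shortSet (Ω : Set (Fin 3 → ℝ)) : Set G :=
  {g | g ∈ cell ∧ rows g 0 ∈ Ω ∧ (rows g 0, rows g 1) ∈ halfDiscPairs}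

theorem measurable_row (i : Fin 3) : Measurable fun g : G => rows g i :=
  (measurable_pi_apply i).comp measurable_rows

theorem measurableSet_shortSet {Ω : Set (Fin 3 → ℝ)} (hΩ : MeasurableSet Ω) :
    MeasurableSet (shortSet Ω) :=
  measurableSet_cell.inter ((measurable_row 0 hΩ).inter
    (((measurable_row 0).prodMk (measurable_row 1)) measurableSet_halfDiscPairs))

/-- This makes `count Ω` count distinct lattice vectors, so its pairs of terms inject into pairs of
vectors. -/
theorem eq_of_smul_mem_shortSet {Ω : Set (Fin 3 → ℝ)} {g : G} {γ γ' : Γ}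
    (h : γ • g ∈ shortSet Ω) (h' : γ' • g ∈ shortSet Ω)
    (e : rows (γ • g) 0 = rows (γ' • g) 0) : γ = γ' := by
  obtain ⟨δ, hδ⟩ := ofInt_surjective (γ' * γ⁻¹)
  have hg : γ' • g = ofInt δ • γ • g := by rw [hδ, smul_smul, inv_mul_cancel_right]
  rw [hg] at h' e
  have := eq_one_of_mem_halfDiscPairs h.1 h'.1 h.2.2 h'.2.2 e.symm
  rw [this] at hδ
  have h1 : ofInt 1 = 1 := Subtype.ext (map_one _)
  rw [h1] at hδ
  exact (mul_inv_eq_one.1 hδ.symm).symm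

theorem rows_eq_or_neg {g : G} {γ γ' : Γ} (h : rows (γ • g) 0 ⨯₃ rows (γ' • g) 0 = 0) :
    rows (γ' • g) 0 = rows (γ • g) 0 ∨ rows (γ' • g) 0 = -rows (γ • g) 0 := by
  obtain ⟨δ, hδ⟩ := ofInt_surjective (γ' * γ⁻¹)
  have hg : γ' • g = ofInt δ • γ • g := by rw [hδ, smul_smul, inv_mul_cancel_right]
  rw [hg] at h ⊢
  obtain ⟨h1, h2, h3⟩ := first_row_eq h
  rw [rows_ofInt_smul, latPt_eq, h1, h2]
  rcases h3 with h3 | h3 <;> simp [h3]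

/-! ### First and second moments of the count. -/

/-- The number of `γ` that move `g` into `shortSet Ω`. -/
def count (Ω : Set (Fin 3 → ℝ)) (g : G) : ℝ≥0∞ :=
  ∑' γ : Γ, (shortSet Ω).indicator 1 (γ • g)

theorem measurable_count {Ω : Set (Fin 3 → ℝ)} (hΩ : MeasurableSet Ω) : Measurable (count Ω) :=
  Measurable.tsum fun γ =>
    measurable_comp_smul (measurable_one.indicator (measurableSet_shortSet hΩ)) γ

theorem lintegral_count {Ω : Set (Fin 3 → ℝ)} (hΩ : MeasurableSet Ω) :
    ∫⁻ g in fundDomain, count Ω g ∂(Measure.haar : Measure G) =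
      cellConst * (ENNReal.ofReal (Real.pi / 2) * volume Ω) := by
  have hm : Measurable fun p : (Fin 3 → ℝ) × (Fin 3 → ℝ) =>
      Ω.indicator (1 : (Fin 3 → ℝ) → ℝ≥0∞) p.1 *
        halfDiscPairs.indicator (1 : (Fin 3 → ℝ) × (Fin 3 → ℝ) → ℝ≥0∞) p :=
    ((measurable_one.indicator hΩ).comp measurable_fst).mul
      (measurable_one.indicator measurableSet_halfDiscPairs)
  rw [← lintegral_halfDiscPairs hΩ, ← lintegral_fundDomain_cell hm]
  refine lintegral_congr fun g => tsum_congr fun γ => ?_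
  simp only [Set.indicator, shortSet, Set.mem_ofPred_eq, Pi.one_apply]
  by_cases h1 : γ • g ∈ cell <;> by_cases h2 : rows (γ • g) 0 ∈ Ω <;>
    by_cases h3 : (rows (γ • g) 0, rows (γ • g) 1) ∈ halfDiscPairs <;> simp [h1, h2, h3]

/-- Parallel first rows agree up to sign, and each sign is realised by at most one `γ'`. -/
theorem tsum_dependent_le {Ω : Set (Fin 3 → ℝ)} {g : G} (γ : Γ) :
    ∑' γ' : Γ, {γ' : Γ | γ' • g ∈ shortSet Ω ∧
      rows (γ • g) 0 ⨯₃ rows (γ' • g) 0 = 0}.indicator (1 : Γ → ℝ≥0∞) γ' ≤ 2 := by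
  classical
  rw [← tsum_subtype]
  let f : {γ' : Γ | γ' • g ∈ shortSet Ω ∧ rows (γ • g) 0 ⨯₃ rows (γ' • g) 0 = 0} → Bool :=
    fun γ' => decide (rows (γ'.1 • g) 0 = rows (γ • g) 0)
  have hf : Function.Injective f := by
    rintro ⟨x, hx, hx'⟩ ⟨y, hy, hy'⟩ hxy
    simp only [f, decide_eq_decide] at hxy
    refine Subtype.ext (eq_of_smul_mem_shortSet hx hy ?_)
    rcases rows_eq_or_neg hx' with h | h <;> rcases rows_eq_or_neg hy' with h' | h'
    · rw [h, h']
    · rw [h, hxy.1 h]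
    · rw [hxy.2 h', h']
    · rw [h, h']
  refine (ENNReal.tsum_comp_le_tsum_of_injective hf (fun _ => (1 : ℝ≥0∞))).trans ?_
  rw [tsum_fintype]
  simp

theorem tsum_independent_le {Ω : Set (Fin 3 → ℝ)} (g : G) :
    ∑' x : Γ × Γ, {x : Γ × Γ | x.1 • g ∈ shortSet Ω ∧ x.2 • g ∈ shortSet Ω ∧
      rows (x.1 • g) 0 ⨯₃ rows (x.2 • g) 0 ≠ 0}.indicator (1 : Γ × Γ → ℝ≥0∞) x ≤
    ∑' x : {x : (Fin 3 → ℤ) × (Fin 3 → ℤ) // latPt x.1 g ⨯₃ latPt x.2 g ≠ 0},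
      Ω.indicator (1 : (Fin 3 → ℝ) → ℝ≥0∞) (latPt x.1.1 g) *
        Ω.indicator (1 : (Fin 3 → ℝ) → ℝ≥0∞) (latPt x.1.2 g) := by
  rw [← tsum_subtype]
  have hz : ∀ γ : Γ, ∃ n : Fin 3 → ℤ, rows (γ • g) 0 = latPt n g := by
    intro γ
    obtain ⟨δ, rfl⟩ := ofInt_surjective γ
    exact ⟨_, rows_ofInt_smul δ g 0⟩
  choose n hn using hz
  let f : {x : Γ × Γ | x.1 • g ∈ shortSet Ω ∧ x.2 • g ∈ shortSet Ω ∧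
      rows (x.1 • g) 0 ⨯₃ rows (x.2 • g) 0 ≠ 0} →
      {x : (Fin 3 → ℤ) × (Fin 3 → ℤ) // latPt x.1 g ⨯₃ latPt x.2 g ≠ 0} := fun x =>
    ⟨(n x.1.1, n x.1.2), by rw [← hn, ← hn]; exact x.2.2.2⟩
  have hf : Function.Injective f := by
    rintro ⟨⟨x1, x2⟩, hx1, hx2, _⟩ ⟨⟨y1, y2⟩, hy1, hy2, _⟩ hxy
    have h := congrArg Subtype.val hxy
    simp only [f, Prod.mk.injEq] at h
    refine Subtype.ext (Prod.ext ?_ ?_)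
    · exact eq_of_smul_mem_shortSet hx1 hy1 ((hn _).trans ((congrArg (latPt · g) h.1).trans (hn _).symm))
    · exact eq_of_smul_mem_shortSet hx2 hy2 ((hn _).trans ((congrArg (latPt · g) h.2).trans (hn _).symm))
  refine le_trans (le_of_eq (tsum_congr fun x => ?_)) (ENNReal.tsum_comp_le_tsum_of_injective hf _)
  have h1 : latPt (f x).1.1 g ∈ Ω := by
    change latPt (n x.1.1) g ∈ Ω
    rw [← hn]; exact x.2.1.2.1
  have h2 : latPt (f x).1.2 g ∈ Ω := by
    change latPt (n x.1.2) g ∈ Ω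
    rw [← hn]; exact x.2.2.1.2.1
  rw [Set.indicator_of_mem h1, Set.indicator_of_mem h2]
  simp

/-- The square is a sum over pairs of group elements, split according to whether their first rows
are parallel. -/
theorem count_sq_le {Ω : Set (Fin 3 → ℝ)} (g : G) :
    count Ω g ^ 2 ≤
    ∑' x : {x : (Fin 3 → ℤ) × (Fin 3 → ℤ) // latPt x.1 g ⨯₃ latPt x.2 g ≠ 0},
      Ω.indicator (1 : (Fin 3 → ℝ) → ℝ≥0∞) (latPt x.1.1 g) *
        Ω.indicator (1 : (Fin 3 → ℝ) → ℝ≥0∞) (latPt x.1.2 g) + 2 * count Ω g := by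
  have h1 : count Ω g ^ 2 = ∑' x : Γ × Γ, (shortSet Ω).indicator (1 : G → ℝ≥0∞) (x.1 • g) *
      (shortSet Ω).indicator (1 : G → ℝ≥0∞) (x.2 • g) := by
    rw [ENNReal.tsum_prod']
    simp only [ENNReal.tsum_mul_left, ENNReal.tsum_mul_right, sq, count]
  have h2 : ∀ x : Γ × Γ, (shortSet Ω).indicator (1 : G → ℝ≥0∞) (x.1 • g) *
      (shortSet Ω).indicator (1 : G → ℝ≥0∞) (x.2 • g) ≤
      {x : Γ × Γ | x.1 • g ∈ shortSet Ω ∧ x.2 • g ∈ shortSet Ω ∧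
        rows (x.1 • g) 0 ⨯₃ rows (x.2 • g) 0 ≠ 0}.indicator (1 : Γ × Γ → ℝ≥0∞) x +
      (shortSet Ω).indicator (1 : G → ℝ≥0∞) (x.1 • g) *
        {γ' : Γ | γ' • g ∈ shortSet Ω ∧
          rows (x.1 • g) 0 ⨯₃ rows (γ' • g) 0 = 0}.indicator (1 : Γ → ℝ≥0∞) x.2 := by
    intro x
    simp only [Set.indicator, Set.mem_ofPred_eq, Pi.one_apply]
    split_ifs <;> simp_all
  rw [h1]
  refine (ENNReal.tsum_le_tsum h2).trans ?_
  rw [ENNReal.tsum_add]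
  refine add_le_add (tsum_independent_le g) ?_
  rw [ENNReal.tsum_prod']
  simp only [ENNReal.tsum_mul_left]
  refine (ENNReal.tsum_le_tsum fun γ => mul_le_mul' le_rfl (tsum_dependent_le γ)).trans ?_
  rw [ENNReal.tsum_mul_right, mul_comm, count]

theorem lintegral_count_sq_le {Ω : Set (Fin 3 → ℝ)} (hΩ : MeasurableSet Ω) :
    ∫⁻ g in fundDomain, count Ω g ^ 2 ∂(Measure.haar : Measure G) ≤
      cellConst * ENNReal.ofReal (5 * Real.pi ^ 2 / 24) * (volume Ω * volume Ω) +
        2 * (cellConst * (ENNReal.ofReal (Real.pi / 2) * volume Ω)) := by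
  have hΩm : Measurable (Ω.indicator (1 : (Fin 3 → ℝ) → ℝ≥0∞)) := measurable_one.indicator hΩ
  refine (lintegral_mono fun g => count_sq_le g).trans ?_
  rw [lintegral_add_right _ ((measurable_count hΩ).const_mul 2),
    lintegral_const_mul _ (measurable_count hΩ), lintegral_count hΩ]
  gcongr
  have hF : Measurable fun p : (Fin 3 → ℝ) × (Fin 3 → ℝ) =>
      Ω.indicator (1 : (Fin 3 → ℝ) → ℝ≥0∞) p.1 * Ω.indicator (1 : (Fin 3 → ℝ) → ℝ≥0∞) p.2 :=
    (hΩm.comp measurable_fst).mul (hΩm.comp measurable_snd)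
  refine (lintegral_indep_le hF).trans (le_of_eq ?_)
  rw [Measure.volume_eq_prod, lintegral_prod_mul hΩm.aemeasurable hΩm.aemeasurable,
    lintegral_indicator_one hΩ]

/-- The second moment inequality for the measure of the support of a function. -/
theorem sq_lintegral_le {α : Type*} [MeasurableSpace α] (ν : Measure α) {f : α → ℝ≥0∞}
    (hf : Measurable f) :
    (∫⁻ x, f x ∂ν) ^ 2 ≤ (∫⁻ x, f x ^ 2 ∂ν) * ν {x | f x ≠ 0} := by
  have hs : MeasurableSet {x | f x ≠ 0} := (measurableSet_singleton (0 : ℝ≥0∞)).compl.preimage hf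
  have h := ENNReal.lintegral_mul_le_Lp_mul_Lq ν Real.HolderConjugate.two_two hf.aemeasurable
    (measurable_one.indicator hs : Measurable ({x | f x ≠ 0}.indicator (1 : α → ℝ≥0∞))).aemeasurable
  have e1 : f * {x | f x ≠ 0}.indicator (1 : α → ℝ≥0∞) = f := by
    funext x
    by_cases hx : f x = 0 <;> simp [Set.indicator, hx]
  have e2 : ∀ x, {x | f x ≠ 0}.indicator (1 : α → ℝ≥0∞) x ^ (2 : ℝ) =
      {x | f x ≠ 0}.indicator (1 : α → ℝ≥0∞) x := by
    intro x
    by_cases hx : f x = 0 <;> simp [Set.indicator, hx]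
  rw [e1] at h
  simp_rw [e2] at h
  rw [lintegral_indicator_one hs] at h
  have h2 := pow_le_pow_left' h 2
  rw [mul_pow, ← ENNReal.rpow_natCast (_ ^ (1 / 2 : ℝ)), ← ENNReal.rpow_natCast (_ ^ (1 / 2 : ℝ)),
    ← ENNReal.rpow_mul, ← ENNReal.rpow_mul] at h2
  norm_num at h2
  simpa using h2

/-- Dividing `hm` by `c π V` leaves `c (π/4) V ≤ (5πV/24 + 1) p`. The worst case is `V = 1`, where
the claim becomes `(π/24)(5π/24 + 1) ≤ 1/4`; `π < 3.15` suffices. -/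
theorem second_moment_bound {c h p V : ℝ} (hh : 0 < h) (hV : 0 ≤ V) (hp : 0 ≤ p)
    (hc : h ≤ c * (5 * Real.pi ^ 2 / 24))
    (hm : (c * (Real.pi / 2 * V)) ^ 2 ≤
      (c * (5 * Real.pi ^ 2 / 24) * (V * V) + 2 * (c * (Real.pi / 2 * V))) * p) :
    min 1 V / 5 * h ≤ p := by
  have hpi := Real.pi_pos
  have hpi1 := Real.pi_lt_d2
  have hc0 : 0 < c := by
    have : 0 < c * (5 * Real.pi ^ 2 / 24) := hh.trans_le hc
    exact pos_of_mul_pos_left this (by positivity)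
  rcases hV.eq_or_lt with rfl | hV
  · simpa using hp
  have h1 : c * (Real.pi / 4 * V) ≤ (5 * Real.pi / 24 * V + 1) * p := by
    have e : 0 < c * Real.pi * V := by positivity
    refine le_of_mul_le_mul_left ?_ e
    linear_combination hm
  have hmin0 : 0 ≤ min 1 V := le_min zero_le_one hV.le
  have hmin1 : min 1 V ≤ 1 := min_le_left _ _
  have hminV : min 1 V ≤ V := min_le_right _ _
  have h2 : min 1 V / 5 * h * (5 * Real.pi / 24 * V + 1) ≤ c * (Real.pi / 4 * V) := by
    have a : min 1 V / 5 * h * (5 * Real.pi / 24 * V + 1) ≤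
        min 1 V / 5 * (c * (5 * Real.pi ^ 2 / 24)) * (5 * Real.pi / 24 * V + 1) := by gcongr
    refine a.trans ?_
    have b : min 1 V * (5 * Real.pi / 24 * V + 1) ≤ V * (5 * Real.pi / 24 + 1) := by
      nlinarith [mul_le_mul_of_nonneg_right hmin1 (show 0 ≤ 5 * Real.pi / 24 * V by positivity)]
    have d : Real.pi / 24 * (5 * Real.pi / 24 + 1) ≤ 1 / 4 := by nlinarith
    calc min 1 V / 5 * (c * (5 * Real.pi ^ 2 / 24)) * (5 * Real.pi / 24 * V + 1)
        = c * Real.pi * (Real.pi / 24) * (min 1 V * (5 * Real.pi / 24 * V + 1)) := by ring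
      _ ≤ c * Real.pi * (Real.pi / 24) * (V * (5 * Real.pi / 24 + 1)) := by gcongr
      _ = c * Real.pi * V * (Real.pi / 24 * (5 * Real.pi / 24 + 1)) := by ring
      _ ≤ c * Real.pi * V * (1 / 4) := by gcongr
      _ = _ := by ring
  exact le_of_mul_le_mul_right ((h2.trans h1).trans_eq (mul_comm _ _)) (by positivity)

theorem haar_fundDomain_ne_top : (Measure.haar : Measure G) fundDomain ≠ ∞ :=
  ne_top_of_le_ne_top (ENNReal.mul_ne_top ENNReal.coe_ne_top ENNReal.ofReal_ne_top)
    haar_fundDomain_le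

theorem min_mul_haar_le {Ω : Set (Fin 3 → ℝ)} (hΩ : MeasurableSet Ω) (hV : volume Ω ≠ ∞) :
    min (1 / 5 : ℝ≥0∞) (volume Ω / 5) * (Measure.haar : Measure G) fundDomain ≤
      (Measure.haar : Measure G).restrict fundDomain {g | count Ω g ≠ 0} := by
  set p := (Measure.haar : Measure G).restrict fundDomain {g | count Ω g ≠ 0} with hp
  have hptop : p ≠ ∞ := ne_top_of_le_ne_top haar_fundDomain_ne_top
    ((measure_mono (Set.subset_univ _)).trans (by simp))
  have h1 := sq_lintegral_le ((Measure.haar : Measure G).restrict fundDomain) (measurable_count hΩ)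
  rw [← hp, lintegral_count hΩ] at h1
  have h2 := h1.trans (mul_le_mul' (lintegral_count_sq_le hΩ) le_rfl)
  have h3 := haar_fundDomain_le
  have h4 := haar_fundDomain_ne_zero
  have h5 := haar_fundDomain_ne_top
  clear_value p
  generalize (Measure.haar : Measure G) fundDomain = h at *
  generalize volume Ω = V at *
  generalize cellConst = c at *
  lift p to NNReal using hptop
  lift h to NNReal using h5
  lift V to NNReal using hV
  have k1 : ((5 * Real.pi ^ 2 / 24).toNNReal : ℝ) = 5 * Real.pi ^ 2 / 24 :=
    Real.coe_toNNReal _ (by positivity)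
  have k2 : ((Real.pi / 2).toNNReal : ℝ) = Real.pi / 2 := Real.coe_toNNReal _ (by positivity)
  simp only [ENNReal.ofReal] at h2 h3
  have h2' : (c * ((Real.pi / 2).toNNReal * V)) ^ 2 ≤
      (c * (5 * Real.pi ^ 2 / 24).toNNReal * (V * V) + 2 * (c * ((Real.pi / 2).toNNReal * V))) * p := by
    exact_mod_cast h2
  have h3' : h ≤ c * (5 * Real.pi ^ 2 / 24).toNNReal := by exact_mod_cast h3
  have h4' : 0 < h := pos_iff_ne_zero.2 (by simpa using h4)
  have key := second_moment_bound (c := c) (h := h) (p := p) (V := V) (by exact_mod_cast h4')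
    V.2 p.2 (by rw [← k1]; exact_mod_cast h3') (by rw [← k1, ← k2]; exact_mod_cast h2')
  have e : min (1 / 5 : ℝ≥0∞) ((V : ℝ≥0∞) / 5) = ((min 1 V / 5 : NNReal) : ℝ≥0∞) := by
    have hmono : Monotone fun x : ℝ≥0∞ => x / 5 := fun _ _ h => ENNReal.div_le_div_right h _
    rw [ENNReal.coe_div (by norm_num), ENNReal.coe_min]
    exact (hmono.map_min (a := 1) (b := (V : ℝ≥0∞))).symm
  rw [e]
  exact_mod_cast key

/-! ### Null sets, measurability and the conclusion. -/

/-- The unipotents `unip 0 r s` preserve the first row and move every `g` into `cell`, so countably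
many translates of a null subset of `cell` cover the set. -/
theorem haar_first_row_null {N : Set (Fin 3 → ℝ)} (hN : MeasurableSet N) (h0 : volume N = 0) :
    (Measure.haar : Measure G) {g | rows g 0 ∈ N} = 0 := by
  have hNm : Measurable fun p : (Fin 3 → ℝ) × (Fin 3 → ℝ) =>
      N.indicator (1 : (Fin 3 → ℝ) → ℝ≥0∞) p.1 :=
    (measurable_one.indicator hN).comp measurable_fst
  have hrm : MeasurableSet {g : G | rows g 0 ∈ N} := measurable_row 0 hN
  have hcell : (Measure.haar : Measure G) (cell ∩ {g | rows g 0 ∈ N}) = 0 := by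
    have h := lintegral_cell hNm
    have e : ∀ g : G, N.indicator (1 : (Fin 3 → ℝ) → ℝ≥0∞) (rows g 0) =
        {g : G | rows g 0 ∈ N}.indicator (1 : G → ℝ≥0∞) g := fun g => rfl
    simp only [e] at h
    rw [lintegral_indicator_one hrm, Measure.restrict_apply hrm,
      Measure.volume_eq_prod, lintegral_prod _ hNm.aemeasurable, Set.inter_comm] at h
    rw [h]
    simp only [lintegral_const]
    rw [lintegral_mul_const _ (measurable_one.indicator hN), lintegral_indicator_one hN, h0,
      zero_mul, mul_zero]
  refine measure_mono_null (t := ⋃ x : ℤ × ℤ, (fun g => (ofInt (unip 0 x.1 x.2) : G) * g) ⁻¹'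
    (cell ∩ {g | rows g 0 ∈ N})) ?_ ?_
  · intro g hg
    obtain ⟨r, s, h⟩ := exists_unip_smul_mem_cell g
    refine Set.mem_iUnion.2 ⟨(r, s), h, ?_⟩
    have := rows_unip_smul_zero r s g
    rw [ofInt_smul] at this
    simp only [Set.mem_ofPred_eq, this]
    exact hg
  · refine measure_iUnion_null fun x => ?_
    rw [measure_preimage_mul, hcell]

/-- A nonzero `n` is a nonzero multiple of the first row of some `δ`, so left invariance and scaling
reduce to the case of first rows. -/
theorem haar_latPt_null {N : Set (Fin 3 → ℝ)} (hN : MeasurableSet N) (h0 : volume N = 0)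
    {n : Fin 3 → ℤ} (hn : n ≠ 0) : (Measure.haar : Measure G) {g | latPt n g ∈ N} = 0 := by
  obtain ⟨δ, a, ha⟩ := exists_vecMul_first n
  have ha0 : (a : ℝ) ≠ 0 := by
    intro h
    have : a = 0 := by exact_mod_cast h
    apply hn
    rw [ha, this]
    ext i
    simp [vecMul, dotProduct, Fin.sum_univ_three]
  have hsub : {g | latPt n g ∈ N} = (fun g => (ofInt δ : G) * g) ⁻¹'
      {g | rows g 0 ∈ (fun v : Fin 3 → ℝ => (a : ℝ) • v) ⁻¹' N} := by
    ext g
    have h1 := latPt_hermite g a 0 δ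
    simp only [Int.cast_zero, zero_smul, add_zero, Int.cast_natCast] at h1
    simp only [Set.mem_ofPred_eq, Set.mem_preimage]
    rw [ha, h1, ofInt_smul]
  rw [hsub, measure_preimage_mul]
  refine haar_first_row_null ((measurable_const_smul (a : ℝ)) hN) ?_
  rw [Measure.addHaar_preimage_smul _ ha0, h0, mul_zero]

theorem mk_mem_B {Ω : Set (Fin 3 → ℝ)} {g : G} :
    Quotient.mk (MulAction.orbitRel Γ G) g ∈ B Ω ↔ ∃ n, latPt n g ∈ Ω := by
  constructor
  · rintro ⟨_, ⟨n, rfl⟩, h⟩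
    exact ⟨n, h⟩
  · rintro ⟨n, h⟩
    exact ⟨_, ⟨n, rfl⟩, h⟩

theorem measurableSet_B {Ω : Set (Fin 3 → ℝ)} (hΩ : MeasurableSet Ω) : MeasurableSet (B Ω) := by
  refine measurableSet_quotient.2 ?_
  have : (Quotient.mk'' : G → X3) ⁻¹' B Ω = ⋃ n : Fin 3 → ℤ, {g | latPt n g ∈ Ω} := by
    ext g
    rw [Set.mem_iUnion]
    exact mk_mem_B
  rw [this]
  exact MeasurableSet.iUnion fun n => (continuous_latPt n).measurable hΩ

theorem μ_apply {S : Set X3} (hS : MeasurableSet S) :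
    μ S = ((Measure.haar : Measure G) fundDomain)⁻¹ * (Measure.haar : Measure G).restrict fundDomain
      (Quotient.mk (MulAction.orbitRel Γ G) ⁻¹' S) := by
  rw [μ, Measure.smul_apply, Measure.map_apply measurable_quotient_mk'' hS, smul_eq_mul]

theorem μ_univ : μ Set.univ = 1 := by
  rw [μ_apply MeasurableSet.univ, Set.preimage_univ, Measure.restrict_apply_univ,
    ENNReal.inv_mul_cancel haar_fundDomain_ne_zero haar_fundDomain_ne_top]

theorem B_mono {Ω Ω' : Set (Fin 3 → ℝ)} (h : Ω ⊆ Ω') : B Ω ⊆ B Ω' :=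
  fun _ hx => hx.mono (Set.inter_subset_inter_right _ h)

theorem B_union (Ω Ω' : Set (Fin 3 → ℝ)) : B (Ω ∪ Ω') = B Ω ∪ B Ω' := by
  ext x
  simp [B, Set.inter_union_distrib_left, Set.union_nonempty]

/-- Each of the countably many nonzero `n` contributes a null set. The origin lies in every lattice,
which is why it must be excluded, also from the measurable hull of `N`. -/
theorem μ_B_null {N : Set (Fin 3 → ℝ)} (hN : volume N = 0) (h0 : (0 : Fin 3 → ℝ) ∉ N) :
    μ (B N) = 0 := by
  have hM : MeasurableSet (toMeasurable volume N \ {0}) :=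
    (measurableSet_toMeasurable _ _).diff (measurableSet_singleton _)
  have hM0 : volume (toMeasurable volume N \ {0}) = 0 :=
    measure_mono_null Set.sdiff_subset (by rwa [measure_toMeasurable])
  refine measure_mono_null (B_mono (Ω' := toMeasurable volume N \ {0})
    fun x hx => ⟨subset_toMeasurable _ _ hx, fun h => h0 (h ▸ hx)⟩) ?_
  rw [μ_apply (measurableSet_B hM)]
  refine mul_eq_zero_of_right _ (Measure.restrict_le_self.absolutelyContinuous ?_)
  refine measure_mono_null (t := ⋃ n : {n : Fin 3 → ℤ // n ≠ 0},
    {g | latPt n.1 g ∈ toMeasurable volume N \ {0}}) ?_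
    (measure_iUnion_null fun n => haar_latPt_null hM hM0 n.2)
  intro g hg
  obtain ⟨n, hn⟩ := mk_mem_B.1 hg
  refine Set.mem_iUnion.2 ⟨⟨n, ?_⟩, hn⟩
  rintro rfl
  exact hn.2 (by simp [latPt_eq])

theorem min_le_μ_B {Ω : Set (Fin 3 → ℝ)} (hΩ : MeasurableSet Ω) (hV : volume Ω ≠ ∞) :
    min (1 / 5 : ℝ≥0∞) (volume Ω / 5) ≤ μ (B Ω) := by
  have h := min_mul_haar_le hΩ hV
  have hsub : {g : G | count Ω g ≠ 0} ⊆ Quotient.mk (MulAction.orbitRel Γ G) ⁻¹' B Ω := by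
    intro g hg
    obtain ⟨γ, hγ⟩ : ∃ γ : Γ, γ • g ∈ shortSet Ω := by
      by_contra! hne
      exact hg (ENNReal.tsum_eq_zero.2 fun γ => Set.indicator_of_notMem (hne γ) _)
    obtain ⟨δ, rfl⟩ := ofInt_surjective γ
    exact mk_mem_B.2 ⟨_, by rw [← rows_ofInt_smul]; exact hγ.2.1⟩
  rw [μ_apply (measurableSet_B hΩ), mul_comm, ← div_eq_mul_inv]
  exact (ENNReal.le_div_iff_mul_le (Or.inl haar_fundDomain_ne_zero)
    (Or.inl haar_fundDomain_ne_top)).2 (h.trans (measure_mono hsub))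

/-- The bound saturates at volume one, so a piece of finite volume above one serves as well as `Ω`.
-/
theorem exists_subset_finite_volume {Ω : Set (Fin 3 → ℝ)} (hΩ : MeasurableSet Ω) :
    ∃ t ⊆ Ω, MeasurableSet t ∧ volume t ≠ ∞ ∧
      min (1 / 5 : ℝ≥0∞) (volume Ω / 5) ≤ min (1 / 5) (volume t / 5) := by
  rcases le_or_gt (volume Ω) 1 with h | h
  · exact ⟨Ω, subset_rfl, hΩ, ne_top_of_le_ne_top ENNReal.one_ne_top h, le_rfl⟩
  · obtain ⟨t, ht, hts, h1, h2⟩ := Measure.exists_subset_measure_lt_top hΩ h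
    refine ⟨t, hts, ht, h2.ne, (min_le_left _ _).trans (le_min le_rfl ?_)⟩
    exact ENNReal.div_le_div_right h1.le _

end UnimodularLattices

end

theorem mainTheorem4 (Ω : Set (Fin 3 → ℝ)) (hΩ : NullMeasurableSet Ω volume) :
    NullMeasurableSet (UnimodularLattices.B Ω) UnimodularLattices.μ ∧
      min (1 / 5 : ℝ≥0∞) (volume Ω / 5) ≤ UnimodularLattices.μ (UnimodularLattices.B Ω) := by
  by_cases h0 : (0 : Fin 3 → ℝ) ∈ Ω
  · have hB : UnimodularLattices.B Ω = Set.univ :=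
      Set.eq_univ_of_forall fun x => ⟨0, zero_mem _, h0⟩
    rw [hB, UnimodularLattices.μ_univ]
    exact ⟨MeasurableSet.univ.nullMeasurableSet,
      (min_le_left _ _).trans (ENNReal.div_le_of_le_mul (by norm_num))⟩
  -- A measurable set inside `Ω` carries the lower bound; the null remainder avoids the origin and
  -- changes `B Ω` only by a null set.
  · obtain ⟨Ω', hsub, hm, hae⟩ := hΩ.exists_measurable_subset_ae_eq
    have hnull : volume (Ω \ Ω') = 0 := ae_le_set.1 hae.symm.le
    have hB : UnimodularLattices.B Ω =
        UnimodularLattices.B Ω' ∪ UnimodularLattices.B (Ω \ Ω') := by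
      rw [← UnimodularLattices.B_union, Set.union_sdiff_cancel hsub]
    constructor
    · rw [hB]
      exact (UnimodularLattices.measurableSet_B hm).nullMeasurableSet.union
        (NullMeasurableSet.of_null (UnimodularLattices.μ_B_null hnull fun h => h0 h.1))
    · obtain ⟨t, hts, htm, htop, hle⟩ := UnimodularLattices.exists_subset_finite_volume hm
      rw [← measure_congr hae]
      exact hle.trans ((UnimodularLattices.min_le_μ_B htm htop).trans
        (measure_mono (UnimodularLattices.B_mono (hts.trans hsub))))
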